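/- **Setting.** Let $m\ge 1$, let $f_i:\mathbb R^{n_i}\to\mathbb R$ ($i=1,\dots,m$) be convex and $L_i$-smooth (differentiable with $L_i$-Lipschitz gradient, $L_i>0$), $A_i\in\mathbb R^{p\times n_i}$ and $b\in\mathbb R^p$. Suppose that $$\min\ \sum_{i=1}^m f_i(y_i)\quad\text{s.t.}\quad \sum_{i=1}^m A_iy_i=b$$ has an optimal solution $y^\star$ with $\|y_i^\star\|\le D$ for all $i$, where $D>0$, and that $\sum_i\lambda_{\min}(A_iA_i^\top)/L_i>0$. For $\epsilon>0$ put $\delta=\epsilon/(mD^2)$, $f_i^\delta=f_i+\frac\delta2\|\cdot\|^2$, and consider the dual of the perturbed problem, $\min_{x\in\mathbb R^p}\sum_i g_i(x)$ with $g_i(x)=(f_i^\delta)^*(A_i^\top x)-\langle b,x\rangle/m$, where $^*$ is the convex conjugate. **Algorithm (Generalized SSNM on the dual).** Let $\ell_i=\|A_i\|_2^2/\delta$ and $\mu_i=\lambda_{\min}(A_iA_i^\top)/(L_i+\delta)$ (smoothness and strong convexity constants of $g_i$), $\mu=\sum_i\mu_i$, $S=\sum_j\sqrt{\ell_j}$,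 $\hat g_i=g_i-\frac{\mu_i}2\|\cdot\|^2$, $\pi_i=\frac{\sqrt{\ell_i}}{2S}+\frac1{2m}$, $\tau_i=\lambda/\pi_i$, with $\lambda=\frac{\sqrt\mu}{4S}$, $\eta=\frac1{4\sqrt\mu S}$ if $\sqrt\mu\le S/m$, and $\lambda=\frac1{4m}$, $\eta=\frac1{4\mu m}$ otherwise. Start with $x^1\in\mathbb R^p$ (arbitrary, independent of $\epsilon$) and $\phi_1=\dots=\phi_m=x^1$. At step $k=1,\dots,K$ draw $i$ with probabilities $(\pi_l)$, put $y=\tau_ix^k+(1-\tau_i)\phi_i$, $\widetilde\nabla=\frac1{\pi_i}(\nabla\hat g_i(y)-\nabla\hat g_i(\phi_i))+\sum_l\nabla\hat g_l(\phi_l)$, $x^{k+1}=\arg\min_{x\in\mathbb R^p}\{\frac\mu2\|x\|^2+\langle\widetilde\nabla,x\rangle+\frac1{2\eta}\|x^k-x\|^2\}$; then draw $j$ independently with the same probabilities and replace $\phi_j$ by $\tau_jx^{k+1}+(1-\tau_j)\phi_j$. The gradients $\nabla\hat g_l(\phi_l)$ are stored. The output is $y_i=\nabla(f_i^\delta)^*(A_i^\top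 x^{K+1})$, $i=1,\dots,m$. The cost is the number of computations of gradients of the $g_i$, plus $m$ for the final computation of the $y_i$. **Claim.** There is a universal constant $C$ such that for all such data and every $x^1$ there is $\epsilon_0>0$ such that for every $0<\epsilon<\epsilon_0$ there is a number of iterations $K$ for which the cost is at most $$C\left(m+\frac{D\sqrt{m/\epsilon}\,\sum_{j=1}^m\|A_j\|_2}{\sqrt{\sum_{i=1}^m\lambda_{\min}(A_iA_i^\top)/L_i}}\right)\log(1/\epsilon),$$ and after $K$, or any larger number of, iterations the output $y$ is an $\epsilon$-solution of the original problem in expectation: $$\mathbb E\left|\sum_{i=1}^m f_i(y_i)-\sum_{i=1}^m f_i(y_i^\star)\right|<\epsilon,\qquad \mathbb E\left\|\sum_{i=1}^m A_iy_i-b\right\|<\epsilon.$$ -/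

import Mathlib

/-- `f` is differentiable with `L`-Lipschitz gradient. -/
def IsLSmooth {d : ℕ} (L : ℝ) (f : EuclideanSpace ℝ (Fin d) → ℝ) : Prop :=
  Differentiable ℝ f ∧ ∀ x y, ‖gradient f x - gradient f y‖ ≤ L * ‖x - y‖

/-- The smallest eigenvalue of `A Aᵀ`. -/
noncomputable def lamMin {p d : ℕ} (A : Matrix (Fin p) (Fin d) ℝ) : ℝ :=
  ⨅ j, (Matrix.isHermitian_mul_conjTranspose_self A).eigenvalues j

/-- The spectral norm `‖A‖₂`. -/
noncomputable def specNorm {p d : ℕ} (A : Matrix (Fin p) (Fin d) ℝ) : ℝ :=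
  ‖(Matrix.toEuclideanLin A).toContinuousLinearMap‖

/-- The residual `A₁ y₁ + ⋯ + A_m y_m - b`. -/
noncomputable def constraintResidual {m p : ℕ} {n : Fin m → ℕ}
    (A : (i : Fin m) → Matrix (Fin p) (Fin (n i)) ℝ) (b : EuclideanSpace ℝ (Fin p))
    (y : (i : Fin m) → EuclideanSpace ℝ (Fin (n i))) : EuclideanSpace ℝ (Fin p) :=
  (∑ i, Matrix.toEuclideanLin (A i) (y i)) - b

/-- `y` is an optimal solution of `min ∑ fᵢ(yᵢ)` subject to `∑ Aᵢ yᵢ = b`. -/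
def IsOptimalSolution {m p : ℕ} {n : Fin m → ℕ}
    (f : (i : Fin m) → EuclideanSpace ℝ (Fin (n i)) → ℝ)
    (A : (i : Fin m) → Matrix (Fin p) (Fin (n i)) ℝ) (b : EuclideanSpace ℝ (Fin p))
    (y : (i : Fin m) → EuclideanSpace ℝ (Fin (n i))) : Prop :=
  constraintResidual A b y = 0 ∧ ∀ z, constraintResidual A b z = 0 → ∑ i, f i (y i) ≤ ∑ i, f i (z i)

/-- The perturbed functions `fᵢ + (δ/2)‖·‖²`. -/
noncomputable def perturb {m : ℕ} {n : Fin m → ℕ} (δ : ℝ)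
    (f : (i : Fin m) → EuclideanSpace ℝ (Fin (n i)) → ℝ) (i : Fin m)
    (y : EuclideanSpace ℝ (Fin (n i))) : ℝ :=
  f i y + δ / 2 * ‖y‖ ^ 2

/-- The convex conjugate `f*(z) = sup_y (⟨z, y⟩ - f(y))`; below it is only taken of strongly convex
functions, for which the supremum is finite. -/
noncomputable def fenchelConj {d : ℕ} (f : EuclideanSpace ℝ (Fin d) → ℝ)
    (z : EuclideanSpace ℝ (Fin d)) : ℝ :=
  ⨆ y, (inner ℝ z y - f y)

/-- The `i`-th summand `gᵢ(x) = fᵢ*(Aᵢᵀ x) - ⟨b, x⟩ / m` of the dual problem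
`min_x ∑ fᵢ*(Aᵢᵀ x) - ⟨b, x⟩`, a finite-sum minimization over `ℝᵖ`. -/
noncomputable def dualTerm {m p : ℕ} {n : Fin m → ℕ}
    (f : (i : Fin m) → EuclideanSpace ℝ (Fin (n i)) → ℝ)
    (A : (i : Fin m) → Matrix (Fin p) (Fin (n i)) ℝ) (b : EuclideanSpace ℝ (Fin p))
    (i : Fin m) (x : EuclideanSpace ℝ (Fin p)) : ℝ :=
  fenchelConj (f i) (Matrix.toEuclideanLin (A i).transpose x) - inner ℝ b x / m

/-- The gradient oracle of the dual problem: the query `(i, x)` is answered by `∇gᵢ(x)`. -/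
noncomputable def dualOracle {m p : ℕ} {n : Fin m → ℕ}
    (f : (i : Fin m) → EuclideanSpace ℝ (Fin (n i)) → ℝ)
    (A : (i : Fin m) → Matrix (Fin p) (Fin (n i)) ℝ) (b : EuclideanSpace ℝ (Fin p))
    (i : Fin m) (x : EuclideanSpace ℝ (Fin p)) : EuclideanSpace ℝ (Fin p) :=
  gradient (dualTerm f A b i) x

/-- The primal point `yᵢ = ∇fᵢ*(Aᵢᵀ x)` recovered from a dual point `x`. -/
noncomputable def recoverPrimal {m p : ℕ} {n : Fin m → ℕ}
    (f : (i : Fin m) → EuclideanSpace ℝ (Fin (n i)) → ℝ)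
    (A : (i : Fin m) → Matrix (Fin p) (Fin (n i)) ℝ) (x : EuclideanSpace ℝ (Fin p))
    (i : Fin m) : EuclideanSpace ℝ (Fin (n i)) :=
  gradient (fenchelConj (f i)) (Matrix.toEuclideanLin (A i).transpose x)

/-- Randomized programs with access to a gradient oracle for `m` functions on `X`: stop with an
output, compute a gradient (function number `i` at the point `x`) and go on with the answer, or
draw an index in `{1, …, m}` with probabilities `w` and go on with it. -/
inductive OracleProg (m : ℕ) (X : Type) : Type
  | done (x : X) : OracleProg m X
  | query (i : Fin m) (x : X) (k : X → OracleProg m X) : OracleProg m X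
  | draw (w : Fin m → ℝ) (k : Fin m → OracleProg m X) : OracleProg m X

/-- The expectation of `φ(output)`, when the oracle answers the query `(i, x)` by `G i x`. -/
noncomputable def OracleProg.expect {m : ℕ} {X : Type} (G : Fin m → X → X) (φ : X → ℝ) :
    OracleProg m X → ℝ
  | .done x => φ x
  | .query i x k => (k (G i x)).expect G φ
  | .draw w k => ∑ i, w i * (k i).expect G φ

/-- The largest number, over all outcomes of the draws, of gradients that the program computes. -/
noncomputable def OracleProg.queries {m : ℕ} {X : Type} (G : Fin m → X → X) :
    OracleProg m X → ℕ
  | .done _ => 0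
  | .query i x k => 1 + (k (G i x)).queries G
  | .draw _ k => Finset.univ.sup fun i => (k i).queries G

/-- Compute the gradients of all `m` functions at `x` and go on with the table of the answers. -/
noncomputable def OracleProg.queryAll {m : ℕ} {X : Type} [Zero X] (x : X)
    (k : (Fin m → X) → OracleProg m X) : OracleProg m X :=
  (List.finRange m).foldr
    (fun i c T => .query i x fun v => c (Function.update T i v)) k 0

namespace SSNM

/-- `∑ⱼ √Lⱼ`. -/
noncomputable def sumSqrt {m : ℕ} (L : Fin m → ℝ) : ℝ := ∑ j, √(L j)

/-- The sampling probabilities `πᵢ = √Lᵢ / (2 ∑ⱼ √Lⱼ) + 1/(2m)`. -/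
noncomputable def prob {m : ℕ} (L : Fin m → ℝ) (i : Fin m) : ℝ :=
  √(L i) / (2 * sumSqrt L) + 1 / (2 * m)

/-- `prob` is a probability vector as soon as some `Lⱼ` is positive. -/
theorem prob_isProb {m : ℕ} (L : Fin m → ℝ) (hL : 0 < sumSqrt L) :
    (∀ i, 0 < prob L i) ∧ ∑ i, prob L i = 1 := by
  have hm : 0 < m := by
    rcases Nat.eq_zero_or_pos m with rfl | h
    · simp [sumSqrt] at hL
    · exact h
  have hm' : (0 : ℝ) < m := by exact_mod_cast hm
  refine ⟨fun i => by unfold prob; positivity, ?_⟩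
  unfold prob
  rw [Finset.sum_add_distrib, ← Finset.sum_div]
  change sumSqrt L / _ + _ = _
  simp only [Finset.sum_const, Finset.card_univ, Fintype.card_fin, nsmul_eq_mul]
  field_simp
  norm_num

/-- The parameter `λ`, for smoothness constants `Lᵢ` and strong convexity constants `μᵢ`. -/
noncomputable def lam {m : ℕ} (L μ : Fin m → ℝ) : ℝ :=
  if √(∑ i, μ i) ≤ sumSqrt L / m then √(∑ i, μ i) / (4 * sumSqrt L) else 1 / (4 * m)

/-- The step size `η`. -/
noncomputable def eta {m : ℕ} (L μ : Fin m → ℝ) : ℝ :=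
  if √(∑ i, μ i) ≤ sumSqrt L / m then 1 / (4 * √(∑ i, μ i) * sumSqrt L)
  else 1 / (4 * (∑ i, μ i) * m)

/-- The momentum weights `τᵢ = λ / πᵢ`. -/
noncomputable def tau {m : ℕ} (L μ : Fin m → ℝ) (i : Fin m) : ℝ := lam L μ / prob L i

/-- The proximal step
`argmin_z { (μ/2)‖z‖² + ⟨v, z⟩ + (1/(2η))‖x - z‖² }`, in closed form. -/
noncomputable def prox {p : ℕ} (η μ : ℝ) (x v : EuclideanSpace ℝ (Fin p)) :
    EuclideanSpace ℝ (Fin p) :=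
  (1 + η * μ)⁻¹ • (x - η • v)

/-- `prox` is the unique minimizer of the proximal objective. -/
theorem prox_spec {p : ℕ} {η μ : ℝ} (hη : 0 < η) (hμ : 0 ≤ μ)
    (x v z : EuclideanSpace ℝ (Fin p)) :
    μ / 2 * ‖z‖ ^ 2 + inner ℝ v z + 1 / (2 * η) * ‖x - z‖ ^ 2 =
      (μ / 2 * ‖prox η μ x v‖ ^ 2 + inner ℝ v (prox η μ x v)
        + 1 / (2 * η) * ‖x - prox η μ x v‖ ^ 2)
      + (μ / 2 + 1 / (2 * η)) * ‖z - prox η μ x v‖ ^ 2 := by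
  have h1 : 0 < 1 + η * μ := by positivity
  have hx : x = (1 + η * μ) • prox η μ x v + η • v := by
    simp [prox, smul_smul, h1.ne']
  generalize prox η μ x v = q at hx ⊢
  subst hx
  simp only [← real_inner_self_eq_norm_sq, inner_sub_left, inner_sub_right, inner_add_left,
    inner_add_right, real_inner_smul_left, real_inner_smul_right]
  rw [real_inner_comm q z, real_inner_comm v z, real_inner_comm q v]
  field_simp
  ring

/-- `K` iterations of Generalized SSNM from the current iterate `x`, the points `φᵢ` and the stored
gradients `Tᵢ = ∇ĝᵢ(φᵢ)`, where `ĝᵢ = gᵢ - (μᵢ/2)‖·‖²` and the oracle returns `∇gᵢ`. -/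
noncomputable def loop {m p : ℕ} (L μ : Fin m → ℝ) :
    ℕ → EuclideanSpace ℝ (Fin p) → (Fin m → EuclideanSpace ℝ (Fin p)) →
      (Fin m → EuclideanSpace ℝ (Fin p)) → OracleProg m (EuclideanSpace ℝ (Fin p))
  | 0, x, _, _ => .done x
  | K + 1, x, φ, T =>
    .draw (prob L) fun i =>
      let y := tau L μ i • x + (1 - tau L μ i) • φ i
      .query i y fun v =>
        let est := (prob L i)⁻¹ • ((v - μ i • y) - T i) + ∑ l, T l
        let x' := prox (eta L μ) (∑ l, μ l) x est
        .draw (prob L) fun j =>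
          let φj := tau L μ j • x' + (1 - tau L μ j) • φ j
          .query j φj fun w =>
            loop L μ K x' (Function.update φ j φj) (Function.update T j (w - μ j • φj))

/-- Generalized SSNM with `K` iterations on `min_x ∑ gᵢ(x)` from the point `x₁`, where `gᵢ` is
`Lᵢ`-smooth and `μᵢ`-strongly convex: all `φᵢ` start at `x₁`, the output is the last iterate. -/
noncomputable def run {m p : ℕ} (L μ : Fin m → ℝ) (x₁ : EuclideanSpace ℝ (Fin p)) (K : ℕ) :
    OracleProg m (EuclideanSpace ℝ (Fin p)) :=
  OracleProg.queryAll x₁ fun T => loop L μ K x₁ (fun _ => x₁) fun i => T i - μ i • x₁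

end SSNM

/-- Generalized SSNM on the dual of the problem with objective `∑ (fᵢ(yᵢ) + (δ/2)‖yᵢ‖²)` and
constraint `∑ Aᵢ yᵢ = b`, where `fᵢ` is `Lᵢ`-smooth: each perturbed function is `(Lᵢ + δ)`-smooth and
`δ`-strongly convex, so that the `i`-th dual summand is `‖Aᵢ‖₂² / δ`-smooth and
`λ_min(Aᵢ Aᵢᵀ) / (Lᵢ + δ)`-strongly convex. -/
noncomputable def dualSSNM {m p : ℕ} {n : Fin m → ℕ}
    (A : (i : Fin m) → Matrix (Fin p) (Fin (n i)) ℝ) (L : Fin m → ℝ) (δ : ℝ)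
    (x₁ : EuclideanSpace ℝ (Fin p)) (K : ℕ) : OracleProg m (EuclideanSpace ℝ (Fin p)) :=
  SSNM.run (fun i => specNorm (A i) ^ 2 / δ) (fun i => lamMin (A i) / (L i + δ)) x₁ K

/-! The perturbation makes every dual summand smooth and biases the primal optimal value by at most
δmD²/2 = ε/2. What remains is a linearly convergent method on the dual and a transfer of the dual
distance to the primal errors.

Smoothness and strong convexity are carried as quadratic bounds on Bregman remainders for an
abstract gradient map. If G ∘ Y = id, conjugation just swaps the arguments of the remainder
(`bregman_fenchelConj`), so the bounds on fᵢ + (δ/2)‖·‖² become reciprocal bounds on its conjugate;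
`hasGradientAt_of_bregman` then identifies Y as the true gradient.

For the algorithm, the potential `lyap` contracts by 1 - λ in expectation
(`sum_prob_mul_sum_lyap_le`). The estimator is unbiased and its variance is controlled by the
remainders of ĝᵢ at φᵢ around yᵢ. The momentum identity behind `inner_ge_of_momentum` supplies these
same remainders with weight 1/τᵢ - 1, and the sampling probabilities are large enough for them to
absorb the variance (`div_mul_prob_le`).

A dual critical point x* recovers the minimizer of the perturbed primal problem. At any other x the
primal errors exceed the bias by at most linear and quadratic terms in r = ‖x - x*‖/δ. Young's
inequality replaces the linear term by ε/4 plus a multiple of r²/ε, so mean-square convergence is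
enough. Since ‖x*‖ is bounded independently of ε, all prefactors are polynomial in 1/ε, and a
multiple of log(1/ε)/λ iterations beats them; `inv_lam_le` turns 1/λ into the stated cost. -/

/-- The Bregman remainder of `g` at `z` around `y`, for the gradient map `G`. -/
noncomputable def bregman {E : Type*} [NormedAddCommGroup E] [InnerProductSpace ℝ E]
    (g : E → ℝ) (G : E → E) (z y : E) : ℝ :=
  g z - g y - inner ℝ (G y) (z - y)

/-! ### Bregman calculus: smoothness and strong convexity as quadratic bounds. -/

section Bregman

variable {E : Type*} [NormedAddCommGroup E] [InnerProductSpace ℝ E]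

theorem bregman_add_bregman (g : E → ℝ) (G : E → E) (z y : E) :
    bregman g G z y + bregman g G y z = inner ℝ (G z - G y) (z - y) := by
  simp only [bregman, inner_sub_left, inner_sub_right]
  ring

theorem bregman_sub_sq (g : E → ℝ) (G : E → E) (c : ℝ) (z y : E) :
    bregman (fun x => g x - c / 2 * ‖x‖ ^ 2) (fun x => G x - c • x) z y
      = bregman g G z y - c / 2 * ‖z - y‖ ^ 2 := by
  simp only [bregman, ← real_inner_self_eq_norm_sq, inner_sub_left, inner_sub_right,
    real_inner_smul_left]
  rw [real_inner_comm z y]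
  ring

theorem bregman_three_point (g : E → ℝ) (G : E → E) (w y z : E) :
    bregman g G w y = bregman g G w z + bregman g G z y + inner ℝ (G z - G y) (w - z) := by
  simp only [bregman, inner_sub_left, inner_sub_right]
  ring

/-- Cocoercivity: the remainder around y stays nonnegative after a step from z along -(G z - G y),
while smoothness limits its value there; the best step length is 1/l. -/
theorem sq_norm_sub_le_bregman {g : E → ℝ} {G : E → E} {l : ℝ} (hl : 0 ≤ l)
    (h0 : ∀ z y, 0 ≤ bregman g G z y) (h1 : ∀ z y, bregman g G z y ≤ l / 2 * ‖z - y‖ ^ 2)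
    (z y : E) : ‖G z - G y‖ ^ 2 ≤ 2 * l * bregman g G z y := by
  have key : ∀ t : ℝ, t * ‖G z - G y‖ ^ 2 - l / 2 * t ^ 2 * ‖G z - G y‖ ^ 2
      ≤ bregman g G z y := by
    intro t
    have h2 := h0 (z - t • (G z - G y)) y
    have h3 := h1 (z - t • (G z - G y)) z
    rw [bregman_three_point g G _ y z] at h2
    have e : z - t • (G z - G y) - z = -(t • (G z - G y)) := by abel
    rw [e] at h2 h3
    rw [norm_neg, norm_smul, mul_pow, Real.norm_eq_abs, sq_abs] at h3
    rw [inner_neg_right, real_inner_smul_right, real_inner_self_eq_norm_sq] at h2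
    linarith
  -- The case l = 0 is needed for summands with Aᵢ = 0. There `key` is linear in t, and the chosen t
  -- makes its left side exceed the remainder by one.
  rcases hl.eq_or_lt with rfl | hl
  · have h := key ((bregman g G z y + 1) / ‖G z - G y‖ ^ 2)
    by_contra hne
    have hpos : 0 < ‖G z - G y‖ ^ 2 := by linarith
    rw [div_mul_cancel₀ _ hpos.ne'] at h
    linarith
  · have h := key l⁻¹
    have e : l⁻¹ * ‖G z - G y‖ ^ 2 - l / 2 * l⁻¹ ^ 2 * ‖G z - G y‖ ^ 2
        = ‖G z - G y‖ ^ 2 / (2 * l) := by field_simp; ring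
    rw [e, div_le_iff₀ (by positivity)] at h
    linarith

theorem bregman_le_of_strong {g : E → ℝ} {G : E → E} {s : ℝ} (hs : 0 < s)
    (h : ∀ z y, s / 2 * ‖z - y‖ ^ 2 ≤ bregman g G z y) (z y : E) :
    bregman g G z y ≤ 1 / s / 2 * ‖G z - G y‖ ^ 2 := by
  have h1 := bregman_add_bregman g G z y
  have h2 := h y z
  have h3 := real_inner_le_norm (G z - G y) (z - y)
  rw [norm_sub_rev] at h2
  have h4 : ‖G z - G y‖ * ‖z - y‖ ≤ 1 / s / 2 * ‖G z - G y‖ ^ 2 + s / 2 * ‖z - y‖ ^ 2 := by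
    have : 0 ≤ (1 / (2 * s)) * (‖G z - G y‖ - s * ‖z - y‖) ^ 2 := by positivity
    have e : (1 / (2 * s)) * (‖G z - G y‖ - s * ‖z - y‖) ^ 2
      = 1 / s / 2 * ‖G z - G y‖ ^ 2 + s / 2 * ‖z - y‖ ^ 2 - ‖G z - G y‖ * ‖z - y‖ := by
      field_simp; ring
    linarith
  linarith

theorem norm_sub_le_of_strong {g : E → ℝ} {G : E → E} {s : ℝ}
    (h : ∀ z y, s / 2 * ‖z - y‖ ^ 2 ≤ bregman g G z y) (z y : E) :
    s * ‖z - y‖ ≤ ‖G z - G y‖ := by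
  have h1 := bregman_add_bregman g G z y
  have h2 := h y z
  have h3 := real_inner_le_norm (G z - G y) (z - y)
  have h5 := h z y
  rw [norm_sub_rev] at h2
  rcases (norm_nonneg (z - y)).eq_or_lt with h0 | h0
  · rw [← h0]; simp
  · have : s * ‖z - y‖ * ‖z - y‖ ≤ ‖G z - G y‖ * ‖z - y‖ := by nlinarith
    exact le_of_mul_le_mul_right this h0

/-- A remainder squeezed between 0 and a quadratic is little-o of ‖z - y‖. -/
theorem hasGradientAt_of_bregman [CompleteSpace E] {g : E → ℝ} {G : E → E} {c : ℝ} {y : E}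
    (h0 : ∀ z, 0 ≤ bregman g G z y) (h1 : ∀ z, bregman g G z y ≤ c * ‖z - y‖ ^ 2) :
    HasGradientAt g (G y) y := by
  rw [hasGradientAt_iff_isLittleO]
  have hO : (fun z => g z - g y - inner ℝ (G y) (z - y)) =O[nhds y] fun z => ‖z - y‖ ^ 2 := by
    refine Asymptotics.IsBigO.of_bound c (Filter.Eventually.of_forall fun z => ?_)
    have h2 := h0 z
    have h3 := h1 z
    rw [bregman] at h2 h3
    rwa [Real.norm_of_nonneg h2, Real.norm_of_nonneg (by positivity)]
  refine hO.trans_isLittleO ?_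
  have : (fun z : E => ‖z - y‖ ^ 2) = fun z => ‖z - y‖ * ‖z - y‖ := by
    ext z; ring
  rw [this]
  have h2 : (fun z : E => ‖z - y‖) =o[nhds y] fun _ => (1 : ℝ) := by
    rw [Asymptotics.isLittleO_one_iff]
    have : Filter.Tendsto (fun z : E => ‖z - y‖) (nhds y) (nhds ‖y - y‖) :=
      (continuous_norm.comp (continuous_id.sub continuous_const)).tendsto y
    simpa using this
  have h3 := h2.mul_isBigO (Asymptotics.isBigO_refl (fun z : E => ‖z - y‖) (nhds y))
  simp only [one_mul] at h3
  exact h3.trans_isBigO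
    (Asymptotics.IsBigO.of_bound 1 (Filter.Eventually.of_forall fun z => by simp))

theorem exists_isMinOn_of_bregman [FiniteDimensional ℝ E] {g : E → ℝ} {G : E → E} {s : ℝ}
    (hs : 0 < s) (hg : Continuous g) (h : ∀ z y, s / 2 * ‖z - y‖ ^ 2 ≤ bregman g G z y) :
    ∃ y, ∀ z, g y ≤ g z := by
  refine hg.exists_forall_le' 0 ?_
  -- Beyond this radius the quadratic (s/2)‖z‖² outweighs the linear term ⟨G 0, z⟩.
  have hc : ∀ᶠ z in Filter.cocompact E, 2 * ‖G 0‖ / s ≤ ‖z‖ :=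
    (tendsto_norm_cocompact_atTop (E := E)).eventually_ge_atTop _
  filter_upwards [hc] with z hz
  have h1 := h z 0
  simp only [bregman, sub_zero] at h1
  have h2 : -(‖G 0‖ * ‖z‖) ≤ inner ℝ (G 0) z := neg_le_of_abs_le (abs_real_inner_le_norm _ _)
  rw [div_le_iff₀ hs] at hz
  nlinarith [norm_nonneg z]

theorem eq_zero_of_isMin_of_bregman {g : E → ℝ} {G : E → E} {l : ℝ} (hl : 0 < l) {y : E}
    (hy : ∀ z, g y ≤ g z) (h1 : ∀ z y, bregman g G z y ≤ l / 2 * ‖z - y‖ ^ 2) : G y = 0 := by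
  have h2 := h1 (y - l⁻¹ • G y) y
  have h3 := hy (y - l⁻¹ • G y)
  have e : y - l⁻¹ • G y - y = -(l⁻¹ • G y) := by abel
  simp only [bregman] at h2
  rw [e, norm_neg, norm_smul, mul_pow, Real.norm_eq_abs, sq_abs, inner_neg_right,
    real_inner_smul_right, real_inner_self_eq_norm_sq] at h2
  have e2 : l / 2 * (l⁻¹ ^ 2 * ‖G y‖ ^ 2) = l⁻¹ * ‖G y‖ ^ 2 / 2 := by field_simp
  have h4 : l⁻¹ * ‖G y‖ ^ 2 ≤ 0 := by linarith
  have h5 : ‖G y‖ ^ 2 ≤ 0 := by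
    by_contra hh
    push Not at hh
    have : 0 < l⁻¹ * ‖G y‖ ^ 2 := by positivity
    linarith
  simpa using h5

theorem hasDerivAt_along_line [CompleteSpace E] {f : E → ℝ} (hd : Differentiable ℝ f)
    (z y : E) (t : ℝ) : HasDerivAt (fun t : ℝ => f (y + t • (z - y)))
      (inner ℝ (gradient f (y + t • (z - y))) (z - y)) t := by
  have h1 : HasDerivAt (fun t : ℝ => y + t • (z - y)) (z - y) t := by
    simpa using ((hasDerivAt_id t).smul_const (z - y)).const_add y
  exact (hd (y + t • (z - y))).hasGradientAt.hasFDerivAt.comp_hasDerivAt t h1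

theorem bregman_nonneg_of_convexOn [CompleteSpace E] {f : E → ℝ}
    (hf : ConvexOn ℝ Set.univ f) (hd : Differentiable ℝ f) (z y : E) :
    0 ≤ bregman f (gradient f) z y := by
  have hline := hasDerivAt_along_line hd z y 0
  rw [zero_smul, add_zero] at hline
  have hc : ConvexOn ℝ Set.univ (fun t : ℝ => f (y + t • (z - y))) := by
    have := hf.comp_affineMap (AffineMap.lineMap y z : ℝ →ᵃ[ℝ] E)
    simpa [Function.comp_def, AffineMap.lineMap_apply, add_comm] using this
  have := hc.le_slope_of_hasDerivAt (Set.mem_univ 0) (Set.mem_univ 1) zero_lt_one hline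
  simp only [slope_def_field, one_smul, zero_smul, add_zero, sub_zero, div_one,
    add_sub_cancel] at this
  rw [bregman]
  linarith

end Bregman

/-- Descent lemma, by monotonicity instead of integration: along the segment, remainder minus
quadratic has nonpositive derivative. -/
theorem IsLSmooth.bregman_le {d : ℕ} {L : ℝ} {f : EuclideanSpace ℝ (Fin d) → ℝ}
    (hf : IsLSmooth L f) (z y : EuclideanSpace ℝ (Fin d)) :
    bregman f (gradient f) z y ≤ L / 2 * ‖z - y‖ ^ 2 := by
  have hline : ∀ t : ℝ, HasDerivAt
      (fun t : ℝ => f (y + t • (z - y)) - t * inner ℝ (gradient f y) (z - y)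
        - L / 2 * t ^ 2 * ‖z - y‖ ^ 2)
      (inner ℝ (gradient f (y + t • (z - y))) (z - y) - inner ℝ (gradient f y) (z - y)
        - L * t * ‖z - y‖ ^ 2) t := by
    intro t
    have h4 := (hasDerivAt_id t).mul_const (inner ℝ (gradient f y) (z - y))
    have h5 := (((hasDerivAt_pow 2 t).const_mul (L / 2)).mul_const (‖z - y‖ ^ 2))
    refine (((hasDerivAt_along_line hf.1 z y t).sub h4).sub h5).congr_deriv ?_
    push_cast
    ring
  have hanti : AntitoneOn (fun t : ℝ => f (y + t • (z - y)) - t * inner ℝ (gradient f y) (z - y)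
        - L / 2 * t ^ 2 * ‖z - y‖ ^ 2) (Set.Icc 0 1) := by
    refine antitoneOn_of_deriv_nonpos (convex_Icc 0 1)
      (fun t _ => (hline t).continuousAt.continuousWithinAt)
      (fun t _ => (hline t).differentiableAt.differentiableWithinAt) fun t ht => ?_
    rw [interior_Icc] at ht
    rw [(hline t).deriv, ← inner_sub_left]
    have h1 := real_inner_le_norm (gradient f (y + t • (z - y)) - gradient f y) (z - y)
    have h2 := hf.2 (y + t • (z - y)) y
    rw [add_sub_cancel_left, norm_smul, Real.norm_of_nonneg ht.1.le] at h2
    nlinarith [norm_nonneg (z - y)]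
  have := hanti (Set.left_mem_Icc.2 zero_le_one) (Set.right_mem_Icc.2 zero_le_one) zero_le_one
  simp only [one_smul, zero_smul, add_zero, add_sub_cancel] at this
  rw [bregman]
  linarith

/-! ### Convex conjugates through an inverse of the gradient map. -/

section Conjugate

variable {d : ℕ} {F : EuclideanSpace ℝ (Fin d) → ℝ}
  {G : EuclideanSpace ℝ (Fin d) → EuclideanSpace ℝ (Fin d)} {s l : ℝ}

theorem continuous_of_bregman (h0 : ∀ z y, 0 ≤ bregman F G z y)
    (h1 : ∀ z y, bregman F G z y ≤ l / 2 * ‖z - y‖ ^ 2) : Continuous F :=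
  continuous_iff_continuousAt.2 fun y =>
    (hasGradientAt_of_bregman (fun z => h0 z y) fun z => h1 z y).continuousAt

/-- Minimize F - ⟨z, ·⟩: strong convexity gives a minimizer, smoothness makes it stationary. Besides
inverting gradients, this later produces the dual critical point, with z = 0. -/
theorem exists_gradient_eq (hs : 0 < s) (hl : 0 < l)
    (h0 : ∀ z y, s / 2 * ‖z - y‖ ^ 2 ≤ bregman F G z y)
    (h1 : ∀ z y, bregman F G z y ≤ l / 2 * ‖z - y‖ ^ 2) (z : EuclideanSpace ℝ (Fin d)) :
    ∃ y, G y = z := by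
  have e : ∀ u v, bregman (fun y => F y - inner ℝ z y) (fun y => G y - z) u v
      = bregman F G u v := by
    intro u v
    simp only [bregman, inner_sub_left, inner_sub_right]
    ring
  have hc : Continuous F := continuous_of_bregman (fun z y => le_trans (by positivity) (h0 z y)) h1
  obtain ⟨y, hy⟩ := exists_isMinOn_of_bregman (g := fun y => F y - inner ℝ z y)
    (G := fun y => G y - z) hs (by fun_prop) (fun u v => by rw [e]; exact h0 u v)
  have := eq_zero_of_isMin_of_bregman (G := fun y => G y - z) hl hy
    (fun u v => by rw [e]; exact h1 u v)
  exact ⟨y, sub_eq_zero.1 this⟩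

theorem fenchelConj_eq {Y : EuclideanSpace ℝ (Fin d) → EuclideanSpace ℝ (Fin d)}
    (hY : ∀ z, G (Y z) = z) (h0 : ∀ z y, 0 ≤ bregman F G z y) (z : EuclideanSpace ℝ (Fin d)) :
    fenchelConj F z = inner ℝ z (Y z) - F (Y z) := by
  have hle : ∀ y, inner ℝ z y - F y ≤ inner ℝ z (Y z) - F (Y z) := by
    intro y
    have := h0 y (Y z)
    simp only [bregman, hY, inner_sub_right] at this
    linarith
  exact le_antisymm (ciSup_le hle)
    (le_ciSup (f := fun y => inner ℝ z y - F y) ⟨_, by rintro _ ⟨y, rfl⟩; exact hle y⟩ (Y z))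

/-- By Fenchel–Young equality at Y z and Y w; the order reversal is what exchanges smoothness with
strong convexity. -/
theorem bregman_fenchelConj {Y : EuclideanSpace ℝ (Fin d) → EuclideanSpace ℝ (Fin d)}
    (hY : ∀ z, G (Y z) = z) (h0 : ∀ z y, 0 ≤ bregman F G z y) (z w : EuclideanSpace ℝ (Fin d)) :
    bregman (fenchelConj F) Y z w = bregman F G (Y w) (Y z) := by
  simp only [bregman, fenchelConj_eq hY h0, hY, inner_sub_right]
  rw [real_inner_comm z (Y w), real_inner_comm w (Y w)]
  ring

end Conjugate

/-! ### Inequalities between the parameters of the algorithm. -/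

namespace SSNM

variable {m p : ℕ}

theorem lam_pos {L μ : Fin m → ℝ} (hS : 0 < sumSqrt L) (hμ : 0 < ∑ i, μ i) : 0 < lam L μ := by
  have hm : (0 : ℝ) < m := by
    rcases Nat.eq_zero_or_pos m with rfl | h
    · simp [sumSqrt] at hS
    · exact_mod_cast h
  unfold lam
  split_ifs <;> positivity

theorem eta_pos {L μ : Fin m → ℝ} (hS : 0 < sumSqrt L) (hμ : 0 < ∑ i, μ i) : 0 < eta L μ := by
  have hm : (0 : ℝ) < m := by
    rcases Nat.eq_zero_or_pos m with rfl | h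
    · simp [sumSqrt] at hS
    · exact_mod_cast h
  unfold eta
  split_ifs <;> positivity

theorem eta_mul {L μ : Fin m → ℝ} (hμ : 0 < ∑ i, μ i) :
    eta L μ * ∑ i, μ i = lam L μ := by
  have h := Real.sq_sqrt hμ.le
  have h0 : 0 < √(∑ i, μ i) := by positivity
  unfold eta lam
  generalize √(∑ i, μ i) = r at *
  rw [← h]
  split_ifs <;> field_simp

theorem lam_mul_le {L μ : Fin m → ℝ} (hS : 0 < sumSqrt L) : lam L μ * (4 * m) ≤ 1 := by
  have hm : (0 : ℝ) < m := by
    rcases Nat.eq_zero_or_pos m with rfl | h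
    · simp [sumSqrt] at hS
    · exact_mod_cast h
  unfold lam
  split_ifs with h
  · rw [le_div_iff₀ hm] at h
    rw [div_mul_eq_mul_div, div_le_one (by positivity)]
    linarith
  · rw [one_div, inv_mul_cancel₀ (by positivity)]

theorem one_sub_lam_nonneg {L μ : Fin m → ℝ} (hS : 0 < sumSqrt L) (hμ : 0 < ∑ i, μ i) :
    0 ≤ 1 - lam L μ := by
  have hm : (1 : ℝ) ≤ m := by
    rcases Nat.eq_zero_or_pos m with rfl | h
    · simp [sumSqrt] at hS
    · exact_mod_cast h
  nlinarith [lam_mul_le (μ := μ) hS, lam_pos hS hμ]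

theorem inv_lam_le {L μ : Fin m → ℝ} (hS : 0 < sumSqrt L) :
    1 / lam L μ ≤ 4 * (sumSqrt L / √(∑ i, μ i) + m) := by
  have h1 : 0 ≤ sumSqrt L / √(∑ i, μ i) := by positivity
  unfold lam
  split_ifs with h
  · rw [one_div_div, mul_div_assoc]
    have : (0 : ℝ) ≤ m := by positivity
    linarith
  · rw [one_div_one_div]
    linarith

/-- An equality in the first regime; in the second, S < m√μ. Of the 16 units, 2 pay for smoothness
(`sum_mul_tau_le`) and 8 for the variance (`div_mul_prob_le`). -/
theorem sq_sumSqrt_mul_lam_le {L μ : Fin m → ℝ} (hS : 0 < sumSqrt L) (hμ : 0 < ∑ i, μ i) :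
    16 * (sumSqrt L ^ 2 * lam L μ) ≤ 1 / eta L μ := by
  have hm : (0 : ℝ) < m := by
    rcases Nat.eq_zero_or_pos m with rfl | h
    · simp [sumSqrt] at hS
    · exact_mod_cast h
  have h2 := Real.sq_sqrt hμ.le
  have h0 : 0 < √(∑ i, μ i) := by positivity
  unfold lam eta
  generalize √(∑ i, μ i) = r at *
  rw [← h2]
  split_ifs with h
  · apply le_of_eq
    field_simp
    norm_num
  · push Not at h
    rw [div_lt_iff₀ hm] at h
    have h3 : sumSqrt L ^ 2 ≤ (r * m) ^ 2 := pow_le_pow_left₀ hS.le h.le 2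
    rw [one_div_one_div, mul_one_div, mul_div_assoc', div_le_iff₀ (by positivity)]
    nlinarith

theorem sqrt_le_prob (L : Fin m → ℝ) (hS : 0 < sumSqrt L) (i : Fin m) :
    √(L i) ≤ 2 * sumSqrt L * prob L i := by
  have h : √(L i) = 2 * sumSqrt L * (√(L i) / (2 * sumSqrt L)) := by field_simp
  rw [prob, mul_add, ← h]
  have : 0 ≤ 2 * sumSqrt L * (1 / (2 * (m : ℝ))) := by positivity
  linarith

/-- This is the role of the uniform half 1/(2m) of the sampling probabilities; the other half gives
`sqrt_le_prob`. -/
theorem tau_le {L μ : Fin m → ℝ} (hS : 0 < sumSqrt L) (i : Fin m) : tau L μ i ≤ 1 / 2 := by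
  have hm : (0 : ℝ) < m := by exact_mod_cast i.pos
  have hp := (prob_isProb L hS).1 i
  have h1 : 1 / (2 * (m : ℝ)) ≤ prob L i := by
    unfold prob
    have : 0 ≤ √(L i) / (2 * sumSqrt L) := by positivity
    linarith
  have h2 := lam_mul_le (μ := μ) hS
  rw [tau, div_le_iff₀ hp]
  rw [div_le_iff₀ (by positivity)] at h1
  have h3 : lam L μ ≤ 1 / (4 * m) := by rwa [le_div_iff₀ (by positivity)]
  have h4 : 1 / (4 * (m : ℝ)) ≤ 1 / 2 * prob L i := by
    rw [div_le_iff₀ (by positivity)]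
    linarith
  linarith

theorem tau_pos {L μ : Fin m → ℝ} (hS : 0 < sumSqrt L) (hμ : 0 < ∑ i, μ i) (i : Fin m) :
    0 < tau L μ i := div_pos (lam_pos hS hμ) ((prob_isProb L hS).1 i)

theorem sum_mul_tau_le {L μ : Fin m → ℝ} (hL : ∀ i, 0 ≤ L i) (hS : 0 < sumSqrt L)
    (hμ : 0 < ∑ i, μ i) : ∑ i, L i * tau L μ i ≤ 2 * (sumSqrt L ^ 2 * lam L μ) := by
  have h : ∀ i, L i * tau L μ i ≤ √(L i) * (2 * sumSqrt L * lam L μ) := by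
    intro i
    have hp := (prob_isProb L hS).1 i
    have hl := lam_pos hS hμ
    rw [tau, mul_div_assoc', div_le_iff₀ hp]
    have h1 := mul_le_mul_of_nonneg_left (sqrt_le_prob L hS i)
      (mul_nonneg (Real.sqrt_nonneg (L i)) hl.le)
    calc L i * lam L μ = √(L i) * lam L μ * √(L i) := by
          rw [mul_right_comm, Real.mul_self_sqrt (hL i)]
      _ ≤ _ := h1
      _ = _ := by ring
  refine (Finset.sum_le_sum fun i _ => h i).trans (le_of_eq ?_)
  rw [← Finset.sum_mul]
  change sumSqrt L * _ = _
  ring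

/-- The inequality by which the variance of the gradient estimator is absorbed. -/
theorem div_mul_prob_le {L μ : Fin m → ℝ} {β : ℝ} (hL : ∀ i, 0 ≤ L i) (hS : 0 < sumSqrt L)
    (hμ : 0 < ∑ i, μ i) (hβ : 8 * (sumSqrt L ^ 2 * lam L μ) ≤ β) (i : Fin m) :
    L i / (β * prob L i) ≤ 1 / tau L μ i - 1 := by
  have hp := (prob_isProb L hS).1 i
  have hl := lam_pos hS hμ
  have hτ := tau_le (μ := μ) hS i
  have hτ0 := tau_pos hS hμ i
  have hβ0 : 0 < β := lt_of_lt_of_le (by positivity) hβ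
  have h1 : 1 / (2 * tau L μ i) ≤ 1 / tau L μ i - 1 := by
    rw [le_sub_iff_add_le, ← sub_nonneg]
    have : 1 / tau L μ i - (1 / (2 * tau L μ i) + 1) = (1 / 2 - tau L μ i) / tau L μ i := by
      field_simp; ring
    rw [this]
    exact div_nonneg (by linarith) hτ0.le
  refine le_trans ?_ h1
  have h2 : L i ≤ (2 * sumSqrt L * prob L i) ^ 2 := by
    rw [← Real.sq_sqrt (hL i)]
    exact pow_le_pow_left₀ (Real.sqrt_nonneg _) (sqrt_le_prob L hS i) 2
  have h3 : 1 / (2 * tau L μ i) = prob L i / (2 * lam L μ) := by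
    rw [tau]; field_simp
  rw [h3, div_le_div_iff₀ (by positivity) (by positivity)]
  have h4 := mul_le_mul_of_nonneg_left hβ (sq_nonneg (prob L i))
  have h5 := mul_le_mul_of_nonneg_right h2 (show 0 ≤ 2 * lam L μ by positivity)
  nlinarith

/-! ### The potential function and its contraction in one iteration. -/

variable {g : Fin m → EuclideanSpace ℝ (Fin p) → ℝ}
  {G : Fin m → EuclideanSpace ℝ (Fin p) → EuclideanSpace ℝ (Fin p)}
  {L μ : Fin m → ℝ} {xs : EuclideanSpace ℝ (Fin p)}

/-- The potential function of Generalized SSNM around the minimizer `xs`. -/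
noncomputable def lyap (L μ : Fin m → ℝ) (g : Fin m → EuclideanSpace ℝ (Fin p) → ℝ)
    (G : Fin m → EuclideanSpace ℝ (Fin p) → EuclideanSpace ℝ (Fin p))
    (xs x : EuclideanSpace ℝ (Fin p)) (φ : Fin m → EuclideanSpace ℝ (Fin p)) : ℝ :=
  (1 / (2 * eta L μ) + ∑ i, μ i) * ‖x - xs‖ ^ 2
    + 1 / lam L μ * ∑ i, bregman (g i) (G i) (φ i) xs

/-- The second draw changes only the j-th remainder, and πⱼ/λ = 1/τⱼ. -/
theorem sum_prob_mul_lyap (hS : 0 < sumSqrt L)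
    (x : EuclideanSpace ℝ (Fin p)) (φ a : Fin m → EuclideanSpace ℝ (Fin p)) :
    ∑ j, prob L j * lyap L μ g G xs x (Function.update φ j (a j))
      = lyap L μ g G xs x φ + ∑ j, 1 / tau L μ j *
        (bregman (g j) (G j) (a j) xs - bregman (g j) (G j) (φ j) xs) := by
  have h : ∀ j, lyap L μ g G xs x (Function.update φ j (a j)) = lyap L μ g G xs x φ
      + 1 / lam L μ * (bregman (g j) (G j) (a j) xs - bregman (g j) (G j) (φ j) xs) := by
    intro j
    have : ∑ i, bregman (g i) (G i) (Function.update φ j (a j) i) xs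
        = ∑ i, bregman (g i) (G i) (φ i) xs
          + (bregman (g j) (G j) (a j) xs - bregman (g j) (G j) (φ j) xs) := by
      rw [← sub_eq_iff_eq_add', ← Finset.sum_sub_distrib, Finset.sum_eq_single j]
      · simp
      · intro i _ hi
        simp [hi]
      · simp
    rw [lyap, this, lyap]
    ring
  have hp := prob_isProb L hS
  simp only [h, mul_add, Finset.sum_add_distrib]
  rw [← Finset.sum_mul, hp.2, one_mul]
  congr 1
  refine Finset.sum_congr rfl fun j _ => ?_
  rw [tau, one_div_div]
  ring

theorem norm_prox_sub_sq {η M : ℝ} (hη : 0 < η) (hM : 0 ≤ M)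
    (x v : EuclideanSpace ℝ (Fin p)) :
    (1 / (2 * η) + M) * ‖prox η M x v - xs‖ ^ 2 = 1 / (2 * η) * ‖x - xs‖ ^ 2
      - 1 / (2 * η) * ‖prox η M x v - x‖ ^ 2
      - inner ℝ (v + M • xs) (prox η M x v - xs) := by
  have h1 : 0 < 1 + η * M := by positivity
  have hx : x = (1 + η * M) • prox η M x v + η • v := by
    simp [prox, smul_smul, h1.ne']
  generalize prox η M x v = q at hx ⊢
  have hv : v = η⁻¹ • (x - (1 + η * M) • q) := by
    rw [hx, add_sub_cancel_left, smul_smul, inv_mul_cancel₀ hη.ne', one_smul]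
  rw [hv]
  simp only [← real_inner_self_eq_norm_sq, inner_sub_left, inner_sub_right, inner_add_left,
    real_inner_smul_left]
  rw [real_inner_comm q x, real_inner_comm xs x, real_inner_comm q xs]
  field_simp
  ring

/-- Variance is at most the second moment, for the importance-sampled estimate of ∑ vⱼ. -/
theorem sum_mul_sq_norm_le {ι E : Type*} [Fintype ι] [NormedAddCommGroup E]
    [InnerProductSpace ℝ E] {w : ι → ℝ} (hw : ∀ i, 0 < w i) (hw1 : ∑ i, w i = 1) (v : ι → E) :
    ∑ i, w i * ‖(w i)⁻¹ • v i - ∑ j, v j‖ ^ 2 ≤ ∑ i, (w i)⁻¹ * ‖v i‖ ^ 2 := by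
  have h : ∀ i, w i * ‖(w i)⁻¹ • v i - ∑ j, v j‖ ^ 2
      = (w i)⁻¹ * ‖v i‖ ^ 2 - 2 * inner ℝ (v i) (∑ j, v j) + w i * ‖∑ j, v j‖ ^ 2 := by
    intro i
    have := (hw i).ne'
    rw [norm_sub_sq_real, norm_smul, real_inner_smul_left, mul_pow, Real.norm_eq_abs, sq_abs]
    field_simp
  simp only [h, Finset.sum_add_distrib, Finset.sum_sub_distrib]
  rw [← Finset.sum_mul, hw1, ← Finset.mul_sum, ← sum_inner, real_inner_self_eq_norm_sq]
  have := sq_nonneg ‖∑ j, v j‖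
  linarith

/-- Writing x - xs = (y - xs) + (1/t - 1)(y - φ) turns the inner product into remainders. The
remainder at φ around y is kept, since it is what absorbs the variance. -/
theorem inner_ge_of_momentum {E : Type*} [NormedAddCommGroup E] [InnerProductSpace ℝ E]
    {g : E → ℝ} {G : E → E} (h0 : ∀ z y, 0 ≤ bregman g G z y) {t : ℝ} (ht : 0 < t)
    {x φ xs y : E} (hy : y = t • x + (1 - t) • φ) :
    1 / t * bregman g G y xs - (1 / t - 1) * bregman g G φ xs
      + (1 / t - 1) * bregman g G φ y ≤ inner ℝ (G y - G xs) (x - xs) := by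
  have e : x - xs = (y - xs) + (t⁻¹ - 1) • (y - φ) := by
    rw [hy]
    match_scalars <;> field_simp <;> ring
  have h1 := bregman_three_point g G φ xs y
  have h2 := bregman_add_bregman g G y xs
  have h3 := h0 xs y
  have h4 : inner ℝ (G y - G xs) (y - φ) = -inner ℝ (G y - G xs) (φ - y) := by
    rw [← inner_neg_right, neg_sub]
  rw [e, inner_add_right, real_inner_smul_right, h4, ← h2, one_div]
  have h5 : inner ℝ (G y - G xs) (φ - y)
    = bregman g G φ xs - bregman g G φ y - bregman g G y xs := by linarith
  rw [h5]
  linarith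

/-- The two momentum points differ by t(x' - x), so after division by t the quadratic error carries
only one factor t. -/
theorem bregman_momentum_le {E : Type*} [NormedAddCommGroup E] [InnerProductSpace ℝ E]
    {g : E → ℝ} {G : E → E} {l : ℝ} (h1 : ∀ z y, bregman g G z y ≤ l / 2 * ‖z - y‖ ^ 2)
    {t : ℝ} (ht : 0 < t) (x x' φ xs : E) :
    1 / t * bregman g G (t • x' + (1 - t) • φ) xs ≤
      1 / t * bregman g G (t • x + (1 - t) • φ) xs
        + inner ℝ (G (t • x + (1 - t) • φ) - G xs) (x' - x) + l * t / 2 * ‖x' - x‖ ^ 2 := by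
  set y := t • x + (1 - t) • φ with hy
  have e : t • x' + (1 - t) • φ - y = t • (x' - x) := by rw [hy]; module
  have h := bregman_three_point g G (t • x' + (1 - t) • φ) xs y
  have h2 := h1 (t • x' + (1 - t) • φ) y
  rw [e, norm_smul, mul_pow, Real.norm_eq_abs, sq_abs] at h2
  rw [h, e, real_inner_smul_right, mul_add, mul_add]
  have h3 := mul_le_mul_of_nonneg_left h2 (show 0 ≤ 1 / t by positivity)
  have e3 : 1 / t * (l / 2 * (t ^ 2 * ‖x' - x‖ ^ 2)) = l * t / 2 * ‖x' - x‖ ^ 2 := by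
    field_simp
  have e4 : 1 / t * (t * inner ℝ (G y - G xs) (x' - x)) = inner ℝ (G y - G xs) (x' - x) := by
    field_simp
  rw [e3] at h3
  rw [e4]
  linarith

theorem neg_inner_le_young {E : Type*} [NormedAddCommGroup E] [InnerProductSpace ℝ E]
    {β : ℝ} (hβ : 0 < β) (e d : E) :
    -inner ℝ e d ≤ 1 / (2 * β) * ‖e‖ ^ 2 + β / 2 * ‖d‖ ^ 2 := by
  have h1 : -inner ℝ e d ≤ ‖e‖ * ‖d‖ := (neg_le_abs _).trans (abs_real_inner_le_norm _ _)
  have h2 : 0 ≤ 1 / (2 * β) * (‖e‖ - β * ‖d‖) ^ 2 := by positivity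
  have e3 : 1 / (2 * β) * (‖e‖ - β * ‖d‖) ^ 2
      = 1 / (2 * β) * ‖e‖ ^ 2 + β / 2 * ‖d‖ ^ 2 - ‖e‖ * ‖d‖ := by
    field_simp; ring
  linarith

/-- One iteration contracts the potential by the factor `1 - λ` in expectation. -/
theorem sum_prob_mul_sum_lyap_le (hL : ∀ i, 0 ≤ L i) (hS : 0 < sumSqrt L) (hμ : 0 < ∑ i, μ i)
    (h0 : ∀ i z y, 0 ≤ bregman (g i) (G i) z y)
    (h1 : ∀ i z y, bregman (g i) (G i) z y ≤ L i / 2 * ‖z - y‖ ^ 2)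
    (hxs : ∑ i, G i xs + (∑ i, μ i) • xs = 0)
    (x : EuclideanSpace ℝ (Fin p)) (φ x' : Fin m → EuclideanSpace ℝ (Fin p))
    (hx' : ∀ i, x' i = prox (eta L μ) (∑ i, μ i) x ((prob L i)⁻¹ •
      (G i (tau L μ i • x + (1 - tau L μ i) • φ i) - G i (φ i)) + ∑ l, G l (φ l))) :
    ∑ i, prob L i * ∑ j, prob L j * lyap L μ g G xs (x' i)
      (Function.update φ j (tau L μ j • x' i + (1 - tau L μ j) • φ j))
      ≤ (1 - lam L μ) * lyap L μ g G xs x φ := by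
  obtain ⟨hp, hp1⟩ := prob_isProb L hS
  have hη := eta_pos hS hμ
  have hl := lam_pos hS hμ
  have hτ := tau_pos hS hμ
  have hSl := sq_sumSqrt_mul_lam_le hS hμ
  have hLτ := sum_mul_tau_le hL hS hμ
  have hSl0 : 0 < sumSqrt L ^ 2 * lam L μ := by positivity
  set M := ∑ i, μ i with hM
  set η := eta L μ with hηd
  set y : Fin m → EuclideanSpace ℝ (Fin p) := fun i => tau L μ i • x + (1 - tau L μ i) • φ i
    with hy
  set Δ : Fin m → EuclideanSpace ℝ (Fin p) := fun i => G i (y i) - G i (φ i) with hΔ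
  -- What remains of the proximal term ‖x' - x‖²/(2η) once the smoothness errors are paid; it is the
  -- Young weight for the noise.
  set β := 1 / η - ∑ i, L i * tau L μ i with hβd
  have hβ8 : 8 * (sumSqrt L ^ 2 * lam L μ) ≤ β := by linarith
  have hβ : 0 < β := by linarith
  set vb : EuclideanSpace ℝ (Fin p) := ∑ i, (G i (y i) - G i xs) with hvb
  -- The estimator recentred at xs: by stationarity, M • xs cancels ∑ G l xs.
  set v : Fin m → EuclideanSpace ℝ (Fin p) := fun i =>
    (prob L i)⁻¹ • Δ i + ∑ l, (G l (φ l) - G l xs) with hv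
  have hvv : ∀ i, v i - vb = (prob L i)⁻¹ • Δ i - ∑ l, Δ l := by
    intro i
    simp only [hv, hvb, hΔ, Finset.sum_sub_distrib]
    abel
  have hmean : ∑ i, prob L i • v i = vb := by
    simp only [hv, hvb, smul_add, Finset.sum_add_distrib, smul_smul, mul_inv_cancel₀ (hp _).ne',
      one_smul]
    rw [← Finset.sum_smul, hp1, one_smul, ← Finset.sum_add_distrib]
    refine Finset.sum_congr rfl fun i _ => ?_
    simp only [hΔ]
    abel
  -- A bound for each outcome of the first draw. Only the noise v i - vb is paired with x' i - x,
  -- because `bregman_momentum_le` supplies the mean part.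
  have path : ∀ i, (1 / (2 * η) + M) * ‖x' i - xs‖ ^ 2
      + ∑ j, 1 / tau L μ j *
        bregman (g j) (G j) (tau L μ j • x' i + (1 - tau L μ j) • φ j) xs
      ≤ 1 / (2 * η) * ‖x - xs‖ ^ 2 - inner ℝ (v i) (x - xs)
        + 1 / (2 * β) * ‖(prob L i)⁻¹ • Δ i - ∑ l, Δ l‖ ^ 2
        + ∑ j, 1 / tau L μ j * bregman (g j) (G j) (y j) xs := by
    intro i
    have e1 := norm_prox_sub_sq (xs := xs) hη hμ.le x ((prob L i)⁻¹ • Δ i + ∑ l, G l (φ l))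
    have e2 : (prob L i)⁻¹ • Δ i + ∑ l, G l (φ l) + M • xs = v i := by
      have : M • xs = -∑ i, G i xs := eq_neg_of_add_eq_zero_right hxs
      simp only [this, hv, Finset.sum_sub_distrib]
      abel
    have e3 : x' i = prox η M x ((prob L i)⁻¹ • Δ i + ∑ l, G l (φ l)) := hx' i
    rw [e2, ← e3] at e1
    have e4 := Finset.sum_le_sum fun j (_ : j ∈ Finset.univ) =>
      bregman_momentum_le (h1 j) (hτ j) x (x' i) (φ j) xs
    rw [Finset.sum_add_distrib, Finset.sum_add_distrib, ← sum_inner, ← Finset.sum_mul,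
      ← Finset.sum_div] at e4
    change _ ≤ _ + inner ℝ vb (x' i - x) + _ at e4
    have e5 := neg_inner_le_young hβ (v i - vb) (x' i - x)
    rw [hvv, ← hvv i, inner_sub_left] at e5
    rw [hvv] at e5
    have e6 : inner ℝ (v i) (x' i - xs)
        = inner ℝ (v i) (x' i - x) + inner ℝ (v i) (x - xs) := by
      rw [← inner_add_right, sub_add_sub_cancel]
    have e7 : β / 2 * ‖x' i - x‖ ^ 2 + (∑ j, L j * tau L μ j) / 2 * ‖x' i - x‖ ^ 2
        = 1 / (2 * η) * ‖x' i - x‖ ^ 2 := by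
      rw [← add_mul, hβd]; field_simp; ring
    rw [e1, e6]
    linarith
  have hlow : ∑ i, (1 / tau L μ i * bregman (g i) (G i) (y i) xs
      - (1 / tau L μ i - 1) * bregman (g i) (G i) (φ i) xs
      + (1 / tau L μ i - 1) * bregman (g i) (G i) (φ i) (y i)) ≤ inner ℝ vb (x - xs) := by
    rw [hvb, sum_inner]
    exact Finset.sum_le_sum fun i _ => inner_ge_of_momentum (h0 i) (hτ i) rfl
  have hvar : ∑ i, prob L i * (1 / (2 * β) * ‖(prob L i)⁻¹ • Δ i - ∑ l, Δ l‖ ^ 2)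
      ≤ ∑ i, (1 / tau L μ i - 1) * bregman (g i) (G i) (φ i) (y i) := by
    calc _ = 1 / (2 * β) * ∑ i, prob L i * ‖(prob L i)⁻¹ • Δ i - ∑ l, Δ l‖ ^ 2 := by
          rw [Finset.mul_sum]
          exact Finset.sum_congr rfl fun i _ => by ring
      _ ≤ 1 / (2 * β) * ∑ i, (prob L i)⁻¹ * ‖Δ i‖ ^ 2 :=
          mul_le_mul_of_nonneg_left (sum_mul_sq_norm_le hp hp1 Δ) (by positivity)
      _ ≤ _ := by
          rw [Finset.mul_sum]
          refine Finset.sum_le_sum fun i _ => ?_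
          have e1 := sq_norm_sub_le_bregman (hL i) (h0 i) (h1 i) (φ i) (y i)
          rw [norm_sub_rev] at e1
          have e2 := mul_le_mul_of_nonneg_right (div_mul_prob_le hL hS hμ hβ8 i)
            (h0 i (φ i) (y i))
          refine le_trans ?_ e2
          have hpi := hp i
          calc 1 / (2 * β) * ((prob L i)⁻¹ * ‖Δ i‖ ^ 2)
              ≤ 1 / (2 * β) * ((prob L i)⁻¹ * (2 * L i * bregman (g i) (G i) (φ i) (y i))) := by
                gcongr
            _ = _ := by field_simp
  simp only [sum_prob_mul_lyap hS]
  simp only [lyap]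
  have hsum : ∑ i, prob L i * ((1 / (2 * η) + M) * ‖x' i - xs‖ ^ 2
      + ∑ j, 1 / tau L μ j *
        bregman (g j) (G j) (tau L μ j • x' i + (1 - tau L μ j) • φ j) xs)
      ≤ 1 / (2 * η) * ‖x - xs‖ ^ 2
        + ∑ i, (1 / tau L μ i - 1) * bregman (g i) (G i) (φ i) xs := by
    refine (Finset.sum_le_sum fun i _ => mul_le_mul_of_nonneg_left (path i) (hp i).le).trans ?_
    simp only [mul_add, mul_sub, Finset.sum_add_distrib, Finset.sum_sub_distrib]
    rw [← Finset.sum_mul, ← Finset.sum_mul, hp1]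
    have e1 : ∑ i, prob L i * inner ℝ (v i) (x - xs) = inner ℝ vb (x - xs) := by
      rw [← hmean, sum_inner]
      exact Finset.sum_congr rfl fun i _ => by rw [real_inner_smul_left]
    rw [e1]
    simp only [Finset.sum_add_distrib, Finset.sum_sub_distrib] at hlow
    linarith
  -- With ηM = λ this is (1 - λ)(1 + 2λ) ≥ 1, that is, λ ≤ 1/2.
  have hrate : 1 / (2 * η) ≤ (1 - lam L μ) * (1 / (2 * η) + M) := by
    have e1 : η * M = lam L μ := eta_mul hμ
    have e2 := lam_mul_le (μ := μ) hS
    have hm : (1 : ℝ) ≤ m := by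
      rcases Nat.eq_zero_or_pos m with rfl | h
      · simp [sumSqrt] at hS
      · exact_mod_cast h
    have e3 : lam L μ ≤ 1 / 2 := by nlinarith
    have e4 : M = lam L μ / η := by rw [← e1]; field_simp
    rw [e4]
    have e5 : (1 - lam L μ) * (1 / (2 * η) + lam L μ / η)
        = (1 / (2 * η)) * ((1 - lam L μ) * (1 + 2 * lam L μ)) := by field_simp
    rw [e5]
    refine le_mul_of_one_le_right (by positivity) ?_
    nlinarith
  have e1 : ∑ i, prob L i * ((1 / (2 * η) + M) * ‖x' i - xs‖ ^ 2
        + 1 / lam L μ * ∑ i, bregman (g i) (G i) (φ i) xs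
        + ∑ j, 1 / tau L μ j * (bregman (g j) (G j)
          (tau L μ j • x' i + (1 - tau L μ j) • φ j) xs - bregman (g j) (G j) (φ j) xs))
      = ∑ i, prob L i * ((1 / (2 * η) + M) * ‖x' i - xs‖ ^ 2
        + ∑ j, 1 / tau L μ j *
          bregman (g j) (G j) (tau L μ j • x' i + (1 - tau L μ j) • φ j) xs)
        + (1 / lam L μ * ∑ i, bregman (g i) (G i) (φ i) xs
          - ∑ j, 1 / tau L μ j * bregman (g j) (G j) (φ j) xs) := by
    simp only [mul_add, mul_sub, Finset.sum_add_distrib, Finset.sum_sub_distrib,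
      ← Finset.sum_mul, hp1]
    ring
  rw [e1]
  have e2 : ∑ i, (1 / tau L μ i - 1) * bregman (g i) (G i) (φ i) xs
      = ∑ i, 1 / tau L μ i * bregman (g i) (G i) (φ i) xs
        - ∑ i, bregman (g i) (G i) (φ i) xs := by
    simp only [sub_mul, one_mul, Finset.sum_sub_distrib]
  rw [e2] at hsum
  have e3 := mul_le_mul_of_nonneg_right hrate (sq_nonneg ‖x - xs‖)
  have e4 : (1 - lam L μ) * (1 / lam L μ * ∑ i, bregman (g i) (G i) (φ i) xs)
      = 1 / lam L μ * ∑ i, bregman (g i) (G i) (φ i) xs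
        - ∑ i, bregman (g i) (G i) (φ i) xs := by field_simp
  rw [mul_add, e4, ← mul_assoc]
  linarith

end SSNM

/-! ### Semantics of the initial pass over all gradients. -/

namespace OracleProg

variable {m : ℕ} {X : Type} [Zero X]

theorem expect_queryAll (G : Fin m → X → X) (ψ : X → ℝ) (x : X)
    (k : (Fin m → X) → OracleProg m X) :
    (queryAll x k).expect G ψ = (k fun i => G i x).expect G ψ := by
  have h : ∀ (l : List (Fin m)) (T : Fin m → X),
      (l.foldr (fun i (c : (Fin m → X) → OracleProg m X) T =>
        .query i x fun v => c (Function.update T i v)) k T).expect G ψ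
      = (k fun i => if i ∈ l then G i x else T i).expect G ψ := by
    intro l
    induction l with
    | nil => intro T; simp
    | cons a l ih =>
      intro T
      rw [List.foldr_cons, expect, ih]
      congr 2
      ext1 i
      by_cases hi : i = a
      · subst hi; simp
      · simp [hi]
  simpa [queryAll] using h (List.finRange m) 0

theorem queries_queryAll (G : Fin m → X → X) (x : X)
    (k : (Fin m → X) → OracleProg m X) :
    (queryAll x k).queries G = m + (k fun i => G i x).queries G := by
  have h : ∀ (l : List (Fin m)) (T : Fin m → X),
      (l.foldr (fun i (c : (Fin m → X) → OracleProg m X) T =>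
        .query i x fun v => c (Function.update T i v)) k T).queries G
      = l.length + (k fun i => if i ∈ l then G i x else T i).queries G := by
    intro l
    induction l with
    | nil => intro T; simp
    | cons a l ih =>
      intro T
      rw [List.foldr_cons, queries, ih, List.length_cons, add_comm l.length 1, add_assoc]
      congr 4
      ext1 i
      by_cases hi : i = a
      · subst hi; simp
      · simp [hi]
  simpa [queryAll] using h (List.finRange m) 0

end OracleProg

/-! ### Query count and convergence of the whole run. -/

namespace SSNM

variable {m p : ℕ} {g : Fin m → EuclideanSpace ℝ (Fin p) → ℝ}
  {O : Fin m → EuclideanSpace ℝ (Fin p) → EuclideanSpace ℝ (Fin p)}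
  {L μ : Fin m → ℝ} {xs : EuclideanSpace ℝ (Fin p)}

theorem queries_loop_le (L μ : Fin m → ℝ) (K : ℕ) (x : EuclideanSpace ℝ (Fin p))
    (φ T : Fin m → EuclideanSpace ℝ (Fin p)) :
    (loop L μ K x φ T).queries O ≤ 2 * K := by
  induction K generalizing x φ T with
  | zero => simp [loop, OracleProg.queries]
  | succ K ih =>
    simp only [loop, OracleProg.queries]
    refine Finset.sup_le fun i _ => ?_
    have : ∀ a b : ℕ, b ≤ 2 * K + 1 → a = 1 → a + b ≤ 2 * (K + 1) := by omega
    refine this _ _ (Finset.sup_le fun j _ => ?_) rfl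
    rw [add_comm]
    exact Nat.add_le_add_right (ih _ _ _) 1

theorem queries_run_le (L μ : Fin m → ℝ) (K : ℕ) (x : EuclideanSpace ℝ (Fin p)) :
    (run L μ x K).queries O ≤ m + 2 * K := by
  rw [run, OracleProg.queries_queryAll]
  exact Nat.add_le_add_left (queries_loop_le L μ K _ _ _) m

/-- Induction with x and φ free: the bound is affine in the potential, so it passes through the
averages over both draws. -/
theorem expect_loop_le (hL : ∀ i, 0 ≤ L i) (hS : 0 < sumSqrt L) (hμ : 0 < ∑ i, μ i)
    (h0 : ∀ i z y, 0 ≤ bregman (g i) (fun z => O i z - μ i • z) z y)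
    (h1 : ∀ i z y, bregman (g i) (fun z => O i z - μ i • z) z y ≤ L i / 2 * ‖z - y‖ ^ 2)
    (hxs : ∑ i, O i xs = 0) {ψ : EuclideanSpace ℝ (Fin p) → ℝ} {α β : ℝ} (hβ : 0 ≤ β)
    (hψ : ∀ z, ψ z ≤ α + β * ((1 / (2 * eta L μ) + ∑ i, μ i) * ‖z - xs‖ ^ 2)) (K : ℕ)
    (x : EuclideanSpace ℝ (Fin p)) (φ : Fin m → EuclideanSpace ℝ (Fin p)) :
    (loop L μ K x φ fun i => O i (φ i) - μ i • φ i).expect O ψ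
      ≤ α + β * (1 - lam L μ) ^ K * lyap L μ g (fun i z => O i z - μ i • z) xs x φ := by
  obtain ⟨hp, hp1⟩ := prob_isProb L hS
  have hl := lam_pos hS hμ
  induction K generalizing x φ with
  | zero =>
    simp only [loop, OracleProg.expect, pow_zero, mul_one]
    refine (hψ x).trans ?_
    rw [lyap]
    gcongr
    have : 0 ≤ 1 / lam L μ * ∑ i, bregman (g i) (fun z => O i z - μ i • z) (φ i) xs :=
      mul_nonneg (by positivity) (Finset.sum_nonneg fun i _ => h0 i _ _)
    linarith
  | succ K ih =>
    have hl1 := one_sub_lam_nonneg hS hμ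
    -- The stored table always consists of the gradients at the current φ.
    have hupd : ∀ j a, Function.update (fun i => O i (φ i) - μ i • φ i) j (O j a - μ j • a)
        = fun i => O i (Function.update φ j a i) - μ i • Function.update φ j a i := by
      intro j a
      ext1 i
      exact (Function.apply_update (fun i z => O i z - μ i • z) φ j a i).symm
    simp only [loop, OracleProg.expect, hupd]
    have hstep := sum_prob_mul_sum_lyap_le (g := g) (G := fun i z => O i z - μ i • z)
      (xs := xs) hL hS hμ h0 h1 (by
        rw [Finset.sum_smul, ← Finset.sum_add_distrib]
        simpa using hxs) x φ _ (fun i => rfl)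
    have hlin : ∀ u : Fin m → Fin m → ℝ, ∑ i, prob L i * ∑ j, prob L j *
        (α + β * (1 - lam L μ) ^ K * u i j)
        = α + β * (1 - lam L μ) ^ K * ∑ i, prob L i * ∑ j, prob L j * u i j := by
      intro u
      simp only [mul_add, Finset.sum_add_distrib, ← Finset.sum_mul, hp1, one_mul]
      congr 1
      simp only [Finset.mul_sum]
      refine Finset.sum_congr rfl fun i _ => Finset.sum_congr rfl fun j _ => by ring
    refine (Finset.sum_le_sum fun i _ => mul_le_mul_of_nonneg_left (Finset.sum_le_sum fun j _ =>
      mul_le_mul_of_nonneg_left (ih _ _) (hp j).le) (hp i).le).trans ?_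
    rw [hlin]
    refine (add_le_add_right (mul_le_mul_of_nonneg_left hstep
      (mul_nonneg hβ (pow_nonneg hl1 K))) α).trans (le_of_eq ?_)
    ring

/-- Linear convergence of Generalized SSNM in mean square. -/
theorem expect_run_le (hL : ∀ i, 0 ≤ L i) (hS : 0 < sumSqrt L) (hμ : 0 < ∑ i, μ i)
    (h0 : ∀ i z y, 0 ≤ bregman (g i) (fun z => O i z - μ i • z) z y)
    (h1 : ∀ i z y, bregman (g i) (fun z => O i z - μ i • z) z y ≤ L i / 2 * ‖z - y‖ ^ 2)
    (hxs : ∑ i, O i xs = 0) {ψ : EuclideanSpace ℝ (Fin p) → ℝ} {α c : ℝ} (hc : 0 ≤ c)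
    (hψ : ∀ z, ψ z ≤ α + c * ‖z - xs‖ ^ 2) (K : ℕ) (x : EuclideanSpace ℝ (Fin p)) :
    (run L μ x K).expect O ψ ≤
      α + c * (1 - lam L μ) ^ K * ((1 + (∑ i, L i) / ∑ i, μ i) * ‖x - xs‖ ^ 2) := by
  have hl := lam_pos hS hμ
  have hη := eta_pos hS hμ
  have hl1 := one_sub_lam_nonneg hS hμ
  set W := 1 / (2 * eta L μ) + ∑ i, μ i with hW
  have hW0 : 0 < W := by positivity
  rw [run, OracleProg.expect_queryAll]
  refine (expect_loop_le (α := α) (β := c / W) hL hS hμ h0 h1 hxs (by positivity) (fun z => ?_) K x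
    (fun _ => x)).trans ?_
  · rw [← mul_assoc, div_mul_cancel₀ _ hW0.ne']
    exact hψ z
  · have hly : lyap L μ g (fun i z => O i z - μ i • z) xs x (fun _ => x)
        ≤ W * ((1 + (∑ i, L i) / ∑ i, μ i) * ‖x - xs‖ ^ 2) := by
      rw [lyap]
      have e1 : ∑ i, bregman (g i) (fun z => O i z - μ i • z) x xs
          ≤ (∑ i, L i) / 2 * ‖x - xs‖ ^ 2 := by
        rw [Finset.sum_div, Finset.sum_mul]
        exact Finset.sum_le_sum fun i _ => h1 i x xs
      have e2 : 1 / lam L μ * ((∑ i, L i) / 2 * ‖x - xs‖ ^ 2)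
          ≤ W * ((∑ i, L i) / (∑ i, μ i) * ‖x - xs‖ ^ 2) := by
        have e3 : 1 / lam L μ * ((∑ i, L i) / 2 * ‖x - xs‖ ^ 2)
            = 1 / (2 * eta L μ) * ((∑ i, L i) / (∑ i, μ i) * ‖x - xs‖ ^ 2) := by
          rw [← eta_mul hμ]; field_simp
        rw [e3]
        have : 0 ≤ ∑ i, L i := Finset.sum_nonneg fun i _ => hL i
        gcongr
        rw [hW]
        linarith
      have e4 := mul_le_mul_of_nonneg_left e1 (show 0 ≤ 1 / lam L μ by positivity)
      rw [← hW, add_mul 1, one_mul, mul_add]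
      linarith
    have e5 : c / W * (1 - lam L μ) ^ K * (W * ((1 + (∑ i, L i) / ∑ i, μ i) * ‖x - xs‖ ^ 2))
        = c * (1 - lam L μ) ^ K * ((1 + (∑ i, L i) / ∑ i, μ i) * ‖x - xs‖ ^ 2) := by
      field_simp
    rw [← e5]
    gcongr

end SSNM

/-! ### Spectral bounds for Aᵢ and its transpose. -/

section Spectral

variable {p d : ℕ} (A : Matrix (Fin p) (Fin d) ℝ)

theorem inner_toEuclideanLin_transpose (x : EuclideanSpace ℝ (Fin p))
    (y : EuclideanSpace ℝ (Fin d)) :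
    inner ℝ (Matrix.toEuclideanLin A.transpose x) y = inner ℝ x (Matrix.toEuclideanLin A y) := by
  rw [← Matrix.conjTranspose_eq_transpose_of_trivial,
    Matrix.toEuclideanLin_conjTranspose_eq_adjoint, LinearMap.adjoint_inner_left]

theorem norm_toEuclideanLin_le (y : EuclideanSpace ℝ (Fin d)) :
    ‖Matrix.toEuclideanLin A y‖ ≤ specNorm A * ‖y‖ :=
  (Matrix.toEuclideanLin A).toContinuousLinearMap.le_opNorm y

theorem specNorm_nonneg : 0 ≤ specNorm A := norm_nonneg _

theorem norm_toEuclideanLin_transpose_le (x : EuclideanSpace ℝ (Fin p)) :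
    ‖Matrix.toEuclideanLin A.transpose x‖ ≤ specNorm A * ‖x‖ := by
  set u := Matrix.toEuclideanLin A.transpose x with hu
  have h1 : ‖u‖ ^ 2 = inner ℝ x (Matrix.toEuclideanLin A u) := by
    rw [← inner_toEuclideanLin_transpose, ← hu, real_inner_self_eq_norm_sq]
  have h2 := real_inner_le_norm x (Matrix.toEuclideanLin A u)
  have h3 := mul_le_mul_of_nonneg_left (norm_toEuclideanLin_le A u) (norm_nonneg x)
  rcases (norm_nonneg u).eq_or_lt with h | h
  · rw [← h]; exact mul_nonneg (specNorm_nonneg A) (norm_nonneg x)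
  · refine le_of_mul_le_mul_right ?_ h
    nlinarith

theorem lamMin_nonneg : 0 ≤ lamMin A :=
  Real.iInf_nonneg fun j => (Matrix.posSemidef_self_mul_conjTranspose A).eigenvalues_nonneg j

theorem lamMin_mul_sq_le (x : EuclideanSpace ℝ (Fin p)) :
    lamMin A * ‖x‖ ^ 2 ≤ ‖Matrix.toEuclideanLin A.transpose x‖ ^ 2 := by
  set hH := Matrix.isHermitian_mul_conjTranspose_self A
  set B := hH.eigenvectorBasis
  have hcomp : ∀ y, Matrix.toEuclideanLin (A * A.conjTranspose) y
      = Matrix.toEuclideanLin A (Matrix.toEuclideanLin A.transpose y) := by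
    intro y
    rw [Matrix.conjTranspose_eq_transpose_of_trivial]
    simp [Matrix.toLpLin_apply, Matrix.mulVec_mulVec]
  have heig : ∀ j, Matrix.toEuclideanLin (A * A.conjTranspose) (B j)
      = hH.eigenvalues j • B j := by
    intro j
    have := hH.mulVec_eigenvectorBasis j
    simp only [Matrix.toLpLin_apply]
    ext1 i
    exact congrFun this i
  have hsymm : ∀ y z, inner ℝ (Matrix.toEuclideanLin (A * A.conjTranspose) y) z
      = inner ℝ y (Matrix.toEuclideanLin (A * A.conjTranspose) z) := by
    intro y z
    rw [hcomp, hcomp, ← inner_toEuclideanLin_transpose, real_inner_comm z,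
      ← inner_toEuclideanLin_transpose, real_inner_comm]
  have h1 : ‖Matrix.toEuclideanLin A.transpose x‖ ^ 2
      = inner ℝ x (Matrix.toEuclideanLin (A * A.conjTranspose) x) := by
    rw [hcomp, ← inner_toEuclideanLin_transpose, real_inner_self_eq_norm_sq]
  rw [h1, ← B.sum_inner_mul_inner x, ← real_inner_self_eq_norm_sq, ← B.sum_inner_mul_inner x,
    Finset.mul_sum]
  refine Finset.sum_le_sum fun j _ => ?_
  have h2 : lamMin A ≤ hH.eigenvalues j := ciInf_le (Set.finite_range _).bddBelow j
  have h3 := mul_le_mul_of_nonneg_right h2 (mul_self_nonneg (inner ℝ (B j) x))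
  rw [← hsymm, heig, real_inner_smul_left, real_inner_comm (B j) x]
  linarith

theorem lamMin_le_sq_specNorm : lamMin A ≤ specNorm A ^ 2 := by
  -- For p = 0 there are no eigenvalues and the infimum defaults to 0; otherwise a unit coordinate
  -- vector is tested.
  rcases Nat.eq_zero_or_pos p with rfl | hp
  · simp only [lamMin, Real.iInf_of_isEmpty]
    positivity
  · have h1 := lamMin_mul_sq_le A (EuclideanSpace.single ⟨0, hp⟩ 1)
    have h2 := norm_toEuclideanLin_transpose_le A (EuclideanSpace.single ⟨0, hp⟩ 1)
    have h3 : ‖EuclideanSpace.single (⟨0, hp⟩ : Fin p) (1 : ℝ)‖ = 1 := by simp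
    rw [h3] at h1 h2
    have := pow_le_pow_left₀ (norm_nonneg _) h2 2
    linarith

end Spectral

/-! ### The perturbed dual problem and its critical point. -/

section Dual

theorem exists_conj_gradient {d : ℕ} {f : EuclideanSpace ℝ (Fin d) → ℝ} {L δ : ℝ} (hL : 0 < L)
    (hδ : 0 < δ) (hc : ConvexOn ℝ Set.univ f) (hs : IsLSmooth L f) :
    ∃ Y : EuclideanSpace ℝ (Fin d) → EuclideanSpace ℝ (Fin d),
      (∀ z, gradient f (Y z) + δ • Y z = z) ∧
      (∀ z w, 1 / (L + δ) / 2 * ‖z - w‖ ^ 2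
        ≤ bregman (fenchelConj fun y => f y + δ / 2 * ‖y‖ ^ 2) Y z w) ∧
      (∀ z w, bregman (fenchelConj fun y => f y + δ / 2 * ‖y‖ ^ 2) Y z w
        ≤ 1 / δ / 2 * ‖z - w‖ ^ 2) ∧
      ∀ z w, δ * ‖Y z - Y w‖ ≤ ‖z - w‖ := by
  set F : EuclideanSpace ℝ (Fin d) → ℝ := fun y => f y + δ / 2 * ‖y‖ ^ 2
  set G : EuclideanSpace ℝ (Fin d) → EuclideanSpace ℝ (Fin d) := fun y => gradient f y + δ • y
  have e : ∀ z y, bregman F G z y = bregman f (gradient f) z y + δ / 2 * ‖z - y‖ ^ 2 := by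
    intro z y
    have := bregman_sub_sq f (gradient f) (-δ) z y
    simp only [neg_smul, sub_neg_eq_add, neg_div, neg_mul] at this
    exact this
  have h0 : ∀ z y, δ / 2 * ‖z - y‖ ^ 2 ≤ bregman F G z y := by
    intro z y
    rw [e]
    linarith [bregman_nonneg_of_convexOn hc hs.1 z y]
  have h1 : ∀ z y, bregman F G z y ≤ (L + δ) / 2 * ‖z - y‖ ^ 2 := by
    intro z y
    rw [e]
    linarith [hs.bregman_le z y]
  have h00 : ∀ z y, 0 ≤ bregman F G z y := fun z y => le_trans (by positivity) (h0 z y)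
  choose Y hY using exists_gradient_eq hδ (by positivity) h0 h1
  refine ⟨Y, hY, fun z w => ?_, fun z w => ?_, fun z w => ?_⟩
  · rw [bregman_fenchelConj hY h00]
    have := sq_norm_sub_le_bregman (show 0 ≤ L + δ by positivity) h00 h1 (Y w) (Y z)
    rw [hY, hY, norm_sub_rev] at this
    rw [div_div, one_div_mul_eq_div, div_le_iff₀ (by positivity)]
    linarith
  · rw [bregman_fenchelConj hY h00]
    have := bregman_le_of_strong hδ h0 (Y w) (Y z)
    rwa [hY, hY, norm_sub_rev] at this
  · have := norm_sub_le_of_strong h0 (Y z) (Y w)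
    rwa [hY, hY] at this

end Dual

section Dual

variable {m p : ℕ} {n : Fin m → ℕ} {f : (i : Fin m) → EuclideanSpace ℝ (Fin (n i)) → ℝ}
  {A : (i : Fin m) → Matrix (Fin p) (Fin (n i)) ℝ} {b : EuclideanSpace ℝ (Fin p)}
  {L : Fin m → ℝ} {δ : ℝ}

/-- Linear terms have zero remainder, and precomposition with Aᵢᵀ puts Aᵢ in front of the gradient.
-/
theorem bregman_dualTerm {F : (i : Fin m) → EuclideanSpace ℝ (Fin (n i)) → ℝ} (i : Fin m)
    (Y : EuclideanSpace ℝ (Fin (n i)) → EuclideanSpace ℝ (Fin (n i)))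
    (z y : EuclideanSpace ℝ (Fin p)) :
    bregman (dualTerm F A b i) (fun x => Matrix.toEuclideanLin (A i)
        (Y (Matrix.toEuclideanLin (A i).transpose x)) - (1 / (m : ℝ)) • b) z y
      = bregman (fenchelConj (F i)) Y (Matrix.toEuclideanLin (A i).transpose z)
        (Matrix.toEuclideanLin (A i).transpose y) := by
  simp only [bregman, dualTerm, inner_sub_left, real_inner_smul_left]
  rw [← map_sub, real_inner_comm _ (Y _), inner_toEuclideanLin_transpose, real_inner_comm (z - y),
    inner_sub_right b]
  ring

/-- First-order facts on the perturbed dual problem. -/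
theorem dual_first_order (hL : ∀ i, 0 < L i) (hδ : 0 < δ)
    (hc : ∀ i, ConvexOn ℝ Set.univ (f i)) (hs : ∀ i, IsLSmooth (L i) (f i)) (i : Fin m) :
    (∀ x, gradient (f i) (recoverPrimal (perturb δ f) A x i)
      + δ • recoverPrimal (perturb δ f) A x i = Matrix.toEuclideanLin (A i).transpose x) ∧
    (∀ x, dualOracle (perturb δ f) A b i x
      = Matrix.toEuclideanLin (A i) (recoverPrimal (perturb δ f) A x i) - (1 / (m : ℝ)) • b) ∧
    (∀ z y, lamMin (A i) / (L i + δ) / 2 * ‖z - y‖ ^ 2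
      ≤ bregman (dualTerm (perturb δ f) A b i) (dualOracle (perturb δ f) A b i) z y) ∧
    (∀ z y, bregman (dualTerm (perturb δ f) A b i) (dualOracle (perturb δ f) A b i) z y
      ≤ specNorm (A i) ^ 2 / δ / 2 * ‖z - y‖ ^ 2) ∧
    ∀ z y, ‖recoverPrimal (perturb δ f) A z i - recoverPrimal (perturb δ f) A y i‖
      ≤ specNorm (A i) * (‖z - y‖ / δ) := by
  obtain ⟨Y, hY, h0, h1, hlip⟩ := exists_conj_gradient (hL i) hδ (hc i) (hs i)
  have hLi := hL i
  change ∀ z w, _ ≤ bregman (fenchelConj (perturb δ f i)) Y z w at h0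
  change ∀ z w, bregman (fenchelConj (perturb δ f i)) Y z w ≤ _ at h1
  have hR : ∀ x, recoverPrimal (perturb δ f) A x i
      = Y (Matrix.toEuclideanLin (A i).transpose x) := fun x =>
    (hasGradientAt_of_bregman (fun z => le_trans (by positivity) (h0 z _))
      fun z => h1 z _).gradient
  have hb0 : ∀ z y, lamMin (A i) / (L i + δ) / 2 * ‖z - y‖ ^ 2
      ≤ bregman (dualTerm (perturb δ f) A b i) (fun x => Matrix.toEuclideanLin (A i)
        (Y (Matrix.toEuclideanLin (A i).transpose x)) - (1 / (m : ℝ)) • b) z y := by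
    intro z y
    rw [bregman_dualTerm]
    refine le_trans ?_ (h0 _ _)
    rw [← map_sub]
    have := mul_le_mul_of_nonneg_left (lamMin_mul_sq_le (A i) (z - y))
      (show 0 ≤ 1 / (L i + δ) / 2 by positivity)
    refine le_trans (le_of_eq ?_) this
    ring
  have hb1 : ∀ z y, bregman (dualTerm (perturb δ f) A b i) (fun x => Matrix.toEuclideanLin (A i)
        (Y (Matrix.toEuclideanLin (A i).transpose x)) - (1 / (m : ℝ)) • b) z y
      ≤ specNorm (A i) ^ 2 / δ / 2 * ‖z - y‖ ^ 2 := by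
    intro z y
    rw [bregman_dualTerm]
    refine (h1 _ _).trans ?_
    rw [← map_sub]
    have := mul_le_mul_of_nonneg_left (pow_le_pow_left₀ (norm_nonneg _)
      (norm_toEuclideanLin_transpose_le (A i) (z - y)) 2) (show 0 ≤ 1 / δ / 2 by positivity)
    refine this.trans (le_of_eq ?_)
    ring
  have hO : dualOracle (perturb δ f) A b i = fun x => Matrix.toEuclideanLin (A i)
        (Y (Matrix.toEuclideanLin (A i).transpose x)) - (1 / (m : ℝ)) • b := by
    ext1 x
    have hlam := lamMin_nonneg (A i)
    exact (hasGradientAt_of_bregman (fun z => le_trans (by positivity) (hb0 z x))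
      fun z => hb1 z x).gradient
  rw [hO]
  refine ⟨fun x => by rw [hR, hY], fun x => by rw [hR], hb0, hb1, fun z y => ?_⟩
  rw [hR, hR, mul_div_assoc', le_div_iff₀ hδ, mul_comm]
  refine (hlip _ _).trans ?_
  rw [← map_sub]
  exact norm_toEuclideanLin_transpose_le (A i) (z - y)

/-- Stationarity is feasibility: the m shares b/m add up to b, so the dual gradient is the primal
residual. -/
theorem exists_dual_critical (hm : 0 < m) (hL : ∀ i, 0 < L i) (hδ : 0 < δ)
    (hc : ∀ i, ConvexOn ℝ Set.univ (f i)) (hs : ∀ i, IsLSmooth (L i) (f i))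
    (hμ : 0 < ∑ i, lamMin (A i) / (L i + δ)) (hl : 0 < ∑ i, specNorm (A i) ^ 2 / δ) :
    ∃ xs, ∑ i, dualOracle (perturb δ f) A b i xs = 0 ∧
      constraintResidual A b (recoverPrimal (perturb δ f) A xs) = 0 := by
  have hd := fun i => dual_first_order (A := A) (b := b) hL hδ hc hs i
  have e : ∀ z y, bregman (fun x => ∑ i, dualTerm (perturb δ f) A b i x)
      (fun x => ∑ i, dualOracle (perturb δ f) A b i x) z y
      = ∑ i, bregman (dualTerm (perturb δ f) A b i) (dualOracle (perturb δ f) A b i) z y := by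
    intro z y
    simp only [bregman, Finset.sum_sub_distrib, sum_inner]
  obtain ⟨xs, hxs⟩ := exists_gradient_eq (F := fun x => ∑ i, dualTerm (perturb δ f) A b i x)
    (G := fun x => ∑ i, dualOracle (perturb δ f) A b i x) hμ hl
    (fun z y => by
      rw [e, Finset.sum_div, Finset.sum_mul]
      exact Finset.sum_le_sum fun i _ => (hd i).2.2.1 z y)
    (fun z y => by
      rw [e, Finset.sum_div, Finset.sum_mul]
      exact Finset.sum_le_sum fun i _ => (hd i).2.2.2.1 z y) 0
  refine ⟨xs, hxs, ?_⟩
  rw [constraintResidual, ← hxs]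
  simp only [fun i => (hd i).2.1 xs, Finset.sum_sub_distrib, Finset.sum_const, Finset.card_univ,
    Fintype.card_fin]
  have : (m : ℝ) ≠ 0 := by positivity
  rw [← Nat.cast_smul_eq_nsmul ℝ, smul_smul, mul_one_div_cancel this, one_smul]

/-- The primal point recovered from a dual critical point solves the perturbed problem. -/
theorem sum_perturb_recoverPrimal_le (hL : ∀ i, 0 < L i) (hδ : 0 < δ)
    (hc : ∀ i, ConvexOn ℝ Set.univ (f i)) (hs : ∀ i, IsLSmooth (L i) (f i))
    {xs : EuclideanSpace ℝ (Fin p)}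
    (hxs : constraintResidual A b (recoverPrimal (perturb δ f) A xs) = 0)
    {y : (i : Fin m) → EuclideanSpace ℝ (Fin (n i))} (hy : constraintResidual A b y = 0) :
    ∑ i, perturb δ f i (recoverPrimal (perturb δ f) A xs i) ≤ ∑ i, perturb δ f i (y i) := by
  have hd := fun i => dual_first_order (A := A) (b := b) hL hδ hc hs i
  set R := recoverPrimal (perturb δ f) A xs
  have h : ∀ i, perturb δ f i (R i)
      + inner ℝ xs (Matrix.toEuclideanLin (A i) (y i) - Matrix.toEuclideanLin (A i) (R i))
      ≤ perturb δ f i (y i) := by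
    intro i
    have h1 := bregman_nonneg_of_convexOn (hc i) (hs i).1 (y i) (R i)
    have h2 : 0 ≤ δ / 2 * ‖y i - R i‖ ^ 2 := by positivity
    have h3 := bregman_sub_sq (f i) (gradient (f i)) (-δ) (y i) (R i)
    simp only [neg_smul, sub_neg_eq_add, neg_div, neg_mul] at h3
    rw [← map_sub, ← inner_toEuclideanLin_transpose, ← (hd i).1 xs]
    have h4 : 0 ≤ bregman (fun x => f i x + δ / 2 * ‖x‖ ^ 2)
      (fun x => gradient (f i) x + δ • x) (y i) (R i) := by rw [h3]; positivity
    rw [bregman] at h4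
    change _ + inner ℝ (gradient (f i) (R i) + δ • R i) _ ≤ _
    simp only [perturb]
    linarith
  have h1 := Finset.sum_le_sum fun i (_ : i ∈ Finset.univ) => h i
  -- The critical point acts as Lagrange multiplier; its term vanishes since both points are
  -- feasible.
  rw [Finset.sum_add_distrib, ← inner_sum, Finset.sum_sub_distrib,
    sub_eq_zero.1 hxs, sub_eq_zero.1 hy, sub_self, inner_zero_right, add_zero] at h1
  exact h1

end Dual

theorem IsLSmooth.abs_sub_le {d : ℕ} {L : ℝ} {f : EuclideanSpace ℝ (Fin d) → ℝ}
    (hf : IsLSmooth L f) (hc : ConvexOn ℝ Set.univ f) (z y : EuclideanSpace ℝ (Fin d)) :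
    |f z - f y| ≤ ‖gradient f y‖ * ‖z - y‖ + L / 2 * ‖z - y‖ ^ 2 := by
  have h0 := bregman_nonneg_of_convexOn hc hf.1 z y
  have h1 := hf.bregman_le z y
  have h2 := abs_le.1 (abs_real_inner_le_norm (gradient f y) (z - y))
  rw [bregman] at h0 h1
  rw [abs_le]
  constructor <;> linarith [h2.1, h2.2]

theorem IsLSmooth.norm_gradient_le {d : ℕ} {L : ℝ} {f : EuclideanSpace ℝ (Fin d) → ℝ}
    (hf : IsLSmooth L f) (y : EuclideanSpace ℝ (Fin d)) :
    ‖gradient f y‖ ≤ ‖gradient f 0‖ + L * ‖y‖ := by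
  have h := hf.2 y 0
  rw [sub_zero] at h
  have := norm_le_norm_add_norm_sub' (gradient f y) (gradient f 0)
  linarith

namespace SSNM

variable {m : ℕ} {L μ : Fin m → ℝ}

theorem exists_iterations (hS : 0 < sumSqrt L) (hμ : 0 < ∑ i, μ i) {ε : ℝ} (hε : 0 < ε)
    (hε1 : ε ≤ 1) (q : ℕ) : ∃ K : ℕ, (∀ K' : ℕ, K ≤ K' → (1 - lam L μ) ^ K' ≤ ε ^ q) ∧
      (K : ℝ) ≤ 4 * q * (sumSqrt L / √(∑ i, μ i) + m) * Real.log (1 / ε) + 1 := by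
  have hl := lam_pos hS hμ
  have hl1 := one_sub_lam_nonneg hS hμ
  have hlog : 0 ≤ Real.log (1 / ε) := Real.log_nonneg (by rwa [one_le_div hε])
  refine ⟨⌈q * Real.log (1 / ε) * (1 / lam L μ)⌉₊, fun K' hK => ?_, ?_⟩
  · have h1 : q * Real.log (1 / ε) * (1 / lam L μ) ≤ K' :=
      (Nat.le_ceil _).trans (by exact_mod_cast hK)
    rw [mul_one_div, div_le_iff₀ hl] at h1
    calc (1 - lam L μ) ^ K' ≤ Real.exp (-lam L μ) ^ K' :=
          pow_le_pow_left₀ hl1 (Real.one_sub_le_exp_neg _) _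
      _ = Real.exp (K' * -lam L μ) := by rw [← Real.exp_nat_mul]
      _ ≤ Real.exp (q * Real.log ε) := by
          apply Real.exp_le_exp.2
          rw [one_div, Real.log_inv] at h1
          linarith
      _ = ε ^ q := by rw [Real.exp_nat_mul, Real.exp_log hε]
  · refine (Nat.ceil_lt_add_one (by positivity)).le.trans ?_
    have h := mul_le_mul_of_nonneg_left (inv_lam_le (μ := μ) hS)
      (show 0 ≤ q * Real.log (1 / ε) by positivity)
    linarith

end SSNM

/-! ### From dual distance to primal errors. -/

section Recovery

variable {m p : ℕ} {n : Fin m → ℕ} {f : (i : Fin m) → EuclideanSpace ℝ (Fin (n i)) → ℝ}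
  {A : (i : Fin m) → Matrix (Fin p) (Fin (n i)) ℝ} {b : EuclideanSpace ℝ (Fin p)}
  {L : Fin m → ℝ} {δ D : ℝ} {xs : EuclideanSpace ℝ (Fin p)}
  {yStar : (i : Fin m) → EuclideanSpace ℝ (Fin (n i))}

/-- Each point is optimal for one of the two problems and feasible for the other. Comparing both
ways bounds the bias and, after cancelling δ/2, the norm of the recovered point uniformly in δ. -/
theorem sum_recoverPrimal_le (hL : ∀ i, 0 < L i) (hδ : 0 < δ)
    (hc : ∀ i, ConvexOn ℝ Set.univ (f i)) (hs : ∀ i, IsLSmooth (L i) (f i))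
    (hxs : constraintResidual A b (recoverPrimal (perturb δ f) A xs) = 0)
    (hy : IsOptimalSolution f A b yStar) (hD : ∀ i, ‖yStar i‖ ≤ D) :
    ∑ i, f i (yStar i) ≤ ∑ i, f i (recoverPrimal (perturb δ f) A xs i) ∧
    ∑ i, f i (recoverPrimal (perturb δ f) A xs i)
      ≤ ∑ i, f i (yStar i) + δ / 2 * (m * D ^ 2) ∧
    ∑ i, ‖recoverPrimal (perturb δ f) A xs i‖ ^ 2 ≤ m * D ^ 2 := by
  have h1 := hy.2 _ hxs
  have h2 := sum_perturb_recoverPrimal_le hL hδ hc hs hxs hy.1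
  simp only [perturb, Finset.sum_add_distrib, ← Finset.mul_sum] at h2
  change _ + δ / 2 * ∑ i, ‖recoverPrimal (perturb δ f) A xs i‖ ^ 2 ≤ _ at h2
  have h3 : ∑ i, ‖yStar i‖ ^ 2 ≤ m * D ^ 2 := by
    have := Finset.sum_le_sum fun i (_ : i ∈ Finset.univ) =>
      pow_le_pow_left₀ (norm_nonneg _) (hD i) 2
    simpa using this
  have h4 : 0 ≤ ∑ i, ‖recoverPrimal (perturb δ f) A xs i‖ ^ 2 :=
    Finset.sum_nonneg fun i _ => sq_nonneg _
  have h5 : δ / 2 * ∑ i, ‖yStar i‖ ^ 2 ≤ δ / 2 * (m * D ^ 2) := by gcongr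
  have h6 : 0 ≤ δ / 2 * ∑ i, ‖recoverPrimal (perturb δ f) A xs i‖ ^ 2 := by positivity
  change ∑ i, f i (yStar i) ≤ ∑ i, f i (recoverPrimal (perturb δ f) A xs i) at h1
  change ∑ i, f i (recoverPrimal (perturb δ f) A xs i) + _ ≤ _ at h2
  refine ⟨h1, by linarith, ?_⟩
  have : δ / 2 * ∑ i, ‖recoverPrimal (perturb δ f) A xs i‖ ^ 2 ≤ δ / 2 * (m * D ^ 2) := by
    linarith
  exact le_of_mul_le_mul_left this (by positivity)

theorem norm_gradient_recoverPrimal_le (hL : ∀ i, 0 < L i) (hs : ∀ i, IsLSmooth (L i) (f i))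
    (hR : ∑ i, ‖recoverPrimal (perturb δ f) A xs i‖ ^ 2 ≤ m * D ^ 2) (i : Fin m) :
    ‖recoverPrimal (perturb δ f) A xs i‖ ≤ √(m * D ^ 2) ∧
    ‖gradient (f i) (recoverPrimal (perturb δ f) A xs i)‖
      ≤ ‖gradient (f i) 0‖ + L i * √(m * D ^ 2) := by
  have h1 : ‖recoverPrimal (perturb δ f) A xs i‖ ^ 2 ≤ m * D ^ 2 :=
    (Finset.single_le_sum (f := fun i => ‖recoverPrimal (perturb δ f) A xs i‖ ^ 2)
      (fun i _ => sq_nonneg _) (Finset.mem_univ i)).trans hR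
  have h2 := Real.le_sqrt_of_sq_le h1
  have hLi := hL i
  exact ⟨h2, ((hs i).norm_gradient_le _).trans (by gcongr)⟩

/-- Keeps the dual solution bounded as ε → 0, through Aᵢᵀxs = ∇fᵢ(yᵢ) + δyᵢ at the recovered point.
-/
theorem sum_lamMin_mul_sq_norm_le (hL : ∀ i, 0 < L i) (hδ : 0 < δ) (hδ1 : δ ≤ 1)
    (hc : ∀ i, ConvexOn ℝ Set.univ (f i)) (hs : ∀ i, IsLSmooth (L i) (f i))
    (hR : ∑ i, ‖recoverPrimal (perturb δ f) A xs i‖ ^ 2 ≤ m * D ^ 2) :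
    (∑ i, lamMin (A i)) * ‖xs‖ ^ 2
      ≤ ∑ i, (‖gradient (f i) 0‖ + L i * √(m * D ^ 2) + √(m * D ^ 2)) ^ 2 := by
  rw [Finset.sum_mul]
  refine Finset.sum_le_sum fun i _ => (lamMin_mul_sq_le (A i) xs).trans ?_
  refine pow_le_pow_left₀ (norm_nonneg _) ?_ 2
  obtain ⟨h1, h2⟩ := norm_gradient_recoverPrimal_le hL hs hR i
  rw [← (dual_first_order (A := A) (b := 0) hL hδ hc hs i).1 xs]
  refine (norm_add_le _ _).trans (add_le_add h2 ?_)
  rw [norm_smul, Real.norm_of_nonneg hδ.le]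
  exact (mul_le_of_le_one_left (norm_nonneg _) hδ1).trans h1

theorem abs_sum_recoverPrimal_sub_le (hL : ∀ i, 0 < L i) (hδ : 0 < δ)
    (hc : ∀ i, ConvexOn ℝ Set.univ (f i)) (hs : ∀ i, IsLSmooth (L i) (f i))
    (hxs : constraintResidual A b (recoverPrimal (perturb δ f) A xs) = 0)
    (hy : IsOptimalSolution f A b yStar) (hD : ∀ i, ‖yStar i‖ ≤ D)
    (z : EuclideanSpace ℝ (Fin p)) :
    |∑ i, f i (recoverPrimal (perturb δ f) A z i) - ∑ i, f i (yStar i)|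
      ≤ δ / 2 * (m * D ^ 2)
        + (∑ i, (‖gradient (f i) 0‖ + L i * √(m * D ^ 2)) * specNorm (A i)) * (‖z - xs‖ / δ)
        + (∑ i, L i / 2 * specNorm (A i) ^ 2) * (‖z - xs‖ / δ) ^ 2 := by
  obtain ⟨h1, h2, hR⟩ := sum_recoverPrimal_le hL hδ hc hs hxs hy hD
  have h3 : |∑ i, f i (recoverPrimal (perturb δ f) A z i)
      - ∑ i, f i (recoverPrimal (perturb δ f) A xs i)|
      ≤ (∑ i, (‖gradient (f i) 0‖ + L i * √(m * D ^ 2)) * specNorm (A i)) * (‖z - xs‖ / δ)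
        + (∑ i, L i / 2 * specNorm (A i) ^ 2) * (‖z - xs‖ / δ) ^ 2 := by
    rw [← Finset.sum_sub_distrib, Finset.sum_mul, Finset.sum_mul, ← Finset.sum_add_distrib]
    refine (Finset.abs_sum_le_sum_abs _ _).trans (Finset.sum_le_sum fun i _ => ?_)
    refine ((hs i).abs_sub_le (hc i) _ _).trans ?_
    have h4 := (norm_gradient_recoverPrimal_le hL hs hR i).2
    have h5 := (dual_first_order (A := A) (b := b) hL hδ hc hs i).2.2.2.2 z xs
    have hLi := hL i
    rw [mul_assoc (_ + _), mul_assoc (L i / 2), ← mul_pow]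
    gcongr
  have h4 := abs_sub_le (∑ i, f i (recoverPrimal (perturb δ f) A z i))
    (∑ i, f i (recoverPrimal (perturb δ f) A xs i)) (∑ i, f i (yStar i))
  rw [abs_of_nonneg (sub_nonneg.2 h1)] at h4
  linarith

theorem norm_constraintResidual_recoverPrimal_le (hL : ∀ i, 0 < L i) (hδ : 0 < δ)
    (hc : ∀ i, ConvexOn ℝ Set.univ (f i)) (hs : ∀ i, IsLSmooth (L i) (f i))
    (hxs : constraintResidual A b (recoverPrimal (perturb δ f) A xs) = 0)
    (z : EuclideanSpace ℝ (Fin p)) :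
    ‖constraintResidual A b (recoverPrimal (perturb δ f) A z)‖
      ≤ (∑ i, specNorm (A i) ^ 2) * (‖z - xs‖ / δ) := by
  rw [← sub_zero (constraintResidual _ _ _), ← hxs, constraintResidual, constraintResidual,
    sub_sub_sub_cancel_right, ← Finset.sum_sub_distrib, Finset.sum_mul]
  refine (norm_sum_le _ _).trans (Finset.sum_le_sum fun i _ => ?_)
  rw [← map_sub]
  refine (norm_toEuclideanLin_le _ _).trans ?_
  rw [pow_two, mul_assoc]
  exact mul_le_mul_of_nonneg_left
    ((dual_first_order (A := A) (b := b) hL hδ hc hs i).2.2.2.2 z xs) (specNorm_nonneg _)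

end Recovery

/-! ### Parameters of the dual in terms of the data, and the final accuracy. -/

section Parameters

variable {m p : ℕ} {n : Fin m → ℕ} {A : (i : Fin m) → Matrix (Fin p) (Fin (n i)) ℝ}
  {L : Fin m → ℝ} {δ : ℝ}

theorem sum_lamMin_pos (h : 0 < ∑ i, lamMin (A i) / L i) :
    0 < ∑ i, lamMin (A i) := by
  refine (Finset.sum_nonneg fun i _ => lamMin_nonneg (A i)).lt_of_ne fun h0 => h.ne' ?_
  refine Finset.sum_eq_zero fun i hi => ?_
  rw [(Finset.sum_eq_zero_iff_of_nonneg fun i _ => lamMin_nonneg (A i)).1 h0.symm i hi, zero_div]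

theorem sum_specNorm_pos (h : 0 < ∑ i, lamMin (A i)) : 0 < ∑ i, specNorm (A i) := by
  refine (Finset.sum_nonneg fun i _ => specNorm_nonneg (A i)).lt_of_ne fun h0 => h.not_ge ?_
  refine Finset.sum_nonpos fun i hi => ?_
  have h1 := lamMin_le_sq_specNorm (A i)
  rwa [(Finset.sum_eq_zero_iff_of_nonneg fun i _ => specNorm_nonneg (A i)).1 h0.symm i hi,
    zero_pow two_ne_zero] at h1

theorem half_sum_le (hL : ∀ i, 0 < L i) (hδ : 0 < δ) (hδL : ∀ i, δ ≤ L i) :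
    (∑ i, lamMin (A i) / L i) / 2 ≤ ∑ i, lamMin (A i) / (L i + δ) := by
  rw [Finset.sum_div]
  refine Finset.sum_le_sum fun i _ => ?_
  have h1 := hL i
  have h2 := hδL i
  rw [div_div]
  exact div_le_div_of_nonneg_left (lamMin_nonneg _) (by positivity) (by linarith)

theorem sumSqrt_specNorm :
    SSNM.sumSqrt (fun i => specNorm (A i) ^ 2 / δ) = (∑ i, specNorm (A i)) * √(1 / δ) := by
  rw [SSNM.sumSqrt, Finset.sum_mul]
  refine Finset.sum_congr rfl fun i _ => ?_
  rw [div_eq_mul_one_div, Real.sqrt_mul (sq_nonneg _), Real.sqrt_sq (specNorm_nonneg _)]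

end Parameters

theorem linear_le_quadratic {ε c r : ℝ} (hε : 0 < ε) :
    c * r ≤ ε / 4 + c ^ 2 / ε * r ^ 2 := by
  have h : ε / 4 + c ^ 2 / ε * r ^ 2 - c * r = (c * r - ε / 2) ^ 2 / ε := by
    field_simp; ring
  have : 0 ≤ (c * r - ε / 2) ^ 2 / ε := by positivity
  linarith

theorem expect_dualSSNM_le {m p : ℕ} {n : Fin m → ℕ}
    {f : (i : Fin m) → EuclideanSpace ℝ (Fin (n i)) → ℝ}
    {A : (i : Fin m) → Matrix (Fin p) (Fin (n i)) ℝ} {b : EuclideanSpace ℝ (Fin p)}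
    {L : Fin m → ℝ} {δ : ℝ} {xs : EuclideanSpace ℝ (Fin p)} (hL : ∀ i, 0 < L i) (hδ : 0 < δ)
    (hc : ∀ i, ConvexOn ℝ Set.univ (f i)) (hs : ∀ i, IsLSmooth (L i) (f i))
    (hS : 0 < SSNM.sumSqrt fun i => specNorm (A i) ^ 2 / δ)
    (hμ : 0 < ∑ i, lamMin (A i) / (L i + δ))
    (hxs : ∑ i, dualOracle (perturb δ f) A b i xs = 0)
    {ψ : EuclideanSpace ℝ (Fin p) → ℝ} {α c : ℝ} (hc0 : 0 ≤ c)
    (hψ : ∀ z, ψ z ≤ α + c * ‖z - xs‖ ^ 2) (x₁ : EuclideanSpace ℝ (Fin p)) (K : ℕ) :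
    (dualSSNM A L δ x₁ K).expect (dualOracle (perturb δ f) A b) ψ ≤
      α + c * (1 - SSNM.lam (fun i => specNorm (A i) ^ 2 / δ)
          fun i => lamMin (A i) / (L i + δ)) ^ K
        * ((1 + (∑ i, specNorm (A i) ^ 2) / δ / ∑ i, lamMin (A i) / (L i + δ))
          * ‖x₁ - xs‖ ^ 2) := by
  have hd := fun i => dual_first_order (A := A) (b := b) hL hδ hc hs i
  rw [Finset.sum_div]
  exact SSNM.expect_run_le (g := fun i x => dualTerm (perturb δ f) A b i x
      - lamMin (A i) / (L i + δ) / 2 * ‖x‖ ^ 2)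
    (O := dualOracle (perturb δ f) A b)
    (L := fun i => specNorm (A i) ^ 2 / δ) (μ := fun i => lamMin (A i) / (L i + δ))
    (fun i => by positivity) hS hμ
    (fun i z y => by
      rw [bregman_sub_sq]
      exact sub_nonneg.2 ((hd i).2.2.1 z y))
    (fun i z y => by
      rw [bregman_sub_sq]
      have h1 := lamMin_nonneg (A i)
      have h2 := hL i
      refine (sub_le_self _ ?_).trans ((hd i).2.2.2.1 z y)
      positivity) hxs hc0 hψ K x₁

theorem queries_dualSSNM_add_le {m p : ℕ} {n : Fin m → ℕ}
    {A : (i : Fin m) → Matrix (Fin p) (Fin (n i)) ℝ} {L : Fin m → ℝ} {δ : ℝ}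
    {O : Fin m → EuclideanSpace ℝ (Fin p) → EuclideanSpace ℝ (Fin p)}
    (x₁ : EuclideanSpace ℝ (Fin p)) (K : ℕ) :
    (((dualSSNM A L δ x₁ K).queries O + m : ℕ) : ℝ) ≤ 2 * m + 2 * K := by
  have := SSNM.queries_run_le (O := O)
    (fun i => specNorm (A i) ^ 2 / δ) (fun i => lamMin (A i) / (L i + δ)) K x₁
  have h2 : (dualSSNM A L δ x₁ K).queries O + m ≤ 2 * m + 2 * K := by
    rw [dualSSNM]; omega
  exact_mod_cast h2

theorem sumSqrt_div_sqrt_le {m p : ℕ} {n : Fin m → ℕ}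
    {A : (i : Fin m) → Matrix (Fin p) (Fin (n i)) ℝ} {D δ ε M μ : ℝ} (hD : 0 < D)
    (hδ : δ = ε / (m * D ^ 2)) (hM : 0 < M) (hμ : M / 2 ≤ μ) :
    SSNM.sumSqrt (fun i => specNorm (A i) ^ 2 / δ) / √μ
      ≤ 2 * (D * √(m / ε) * (∑ j, specNorm (A j)) / √M) := by
  have e1 : √(1 / δ) = D * √(m / ε) := by
    rw [hδ, one_div_div, mul_comm (m : ℝ), mul_div_assoc, Real.sqrt_mul (sq_nonneg D),
      Real.sqrt_sq hD.le]
  have e2 : √M / 2 ≤ √μ := by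
    apply Real.le_sqrt_of_sq_le
    rw [div_pow, Real.sq_sqrt hM.le]
    linarith
  have h0 : 0 ≤ ∑ j, specNorm (A j) := Finset.sum_nonneg fun i _ => specNorm_nonneg _
  rw [sumSqrt_specNorm, e1, mul_comm]
  calc D * √(m / ε) * (∑ j, specNorm (A j)) / √μ
      ≤ D * √(m / ε) * (∑ j, specNorm (A j)) / (√M / 2) := by gcongr
    _ = _ := by field_simp

/-- The final accuracy: `u ≤ ε ^ 6` outweighs the polynomial dependence of the constants on
`1 / ε`. -/
theorem accuracy_lt {ε δ N M μ a c₂ c₃ Q u r : ℝ} (hε : 0 < ε) (hε1 : ε ≤ 1) (hN : 0 < N)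
    (hM : 0 < M) (hδ : δ = ε / N) (ha : 0 ≤ a) (hc₂ : 0 ≤ c₂) (hc₃ : 0 < c₃) (hμ : M / 2 ≤ μ)
    (hr0 : 0 ≤ r) (hr : r ≤ Q) (hu0 : 0 ≤ u) (hu : u ≤ ε ^ 6)
    (hP : ε < 1 / (4 * ((a + c₂) * N ^ 2 * (1 + 2 * c₃ * N / M) * Q + 1))) :
    3 * ε / 4 + (a / ε + c₂) / δ ^ 2 * u * ((1 + c₃ / δ / μ) * r) < ε := by
  have hδ0 : 0 < δ := by rw [hδ]; positivity
  have hμ0 : 0 < μ := by linarith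
  have hQ : 0 ≤ Q := hr0.trans hr
  have h2 : 1 + c₃ / δ / μ ≤ (1 + 2 * c₃ * N / M) / ε := by
    have h3 : c₃ / δ / μ ≤ c₃ / δ / (M / 2) := by gcongr
    have h4 : c₃ / δ / (M / 2) = 2 * c₃ * N / M / ε := by
      rw [hδ]; field_simp
    have h5 : 1 ≤ 1 / ε := by rwa [one_le_div hε]
    rw [add_div]
    linarith
  -- Three powers of 1/ε here and one from `h2`; against u ≤ ε⁶ this leaves ε², and `hP` makes its
  -- coefficient times ε less than 1/4.
  have h3 : (a / ε + c₂) / δ ^ 2 ≤ (a + c₂) * N ^ 2 / ε ^ 3 := by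
    have h4 : a / ε + c₂ ≤ (a + c₂) / ε := by
      rw [add_div]
      have : c₂ ≤ c₂ / ε := le_div_self hc₂ hε hε1
      linarith
    calc (a / ε + c₂) / δ ^ 2 ≤ (a + c₂) / ε / δ ^ 2 := by gcongr
      _ = _ := by rw [hδ]; field_simp
  calc _ ≤ 3 * ε / 4 + (a + c₂) * N ^ 2 / ε ^ 3 * ε ^ 6
        * ((1 + 2 * c₃ * N / M) / ε * Q) := by gcongr
    _ = 3 * ε / 4 + (a + c₂) * N ^ 2 * (1 + 2 * c₃ * N / M) * Q * ε * ε := by field_simp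
    _ < ε := by
      rw [lt_div_iff₀ (by positivity)] at hP
      have : (a + c₂) * N ^ 2 * (1 + 2 * c₃ * N / M) * Q * ε < 1 / 4 := by linarith
      nlinarith

set_option maxHeartbeats 1000000 in
theorem corollary5p1 :
    ∃ C : ℝ, 0 < C ∧
      ∀ (m p : ℕ) (n : Fin m → ℕ)
        (f : (i : Fin m) → EuclideanSpace ℝ (Fin (n i)) → ℝ)
        (A : (i : Fin m) → Matrix (Fin p) (Fin (n i)) ℝ)
        (b : EuclideanSpace ℝ (Fin p)) (L : Fin m → ℝ) (D : ℝ)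
        (yStar : (i : Fin m) → EuclideanSpace ℝ (Fin (n i)))
        (x₁ : EuclideanSpace ℝ (Fin p)),
        (∀ i, 0 < L i) → (∀ i, ConvexOn ℝ Set.univ (f i)) → (∀ i, IsLSmooth (L i) (f i)) →
        0 < D → IsOptimalSolution f A b yStar → (∀ i, ‖yStar i‖ ≤ D) →
        0 < ∑ i, lamMin (A i) / L i →
        ∃ ε₀ : ℝ, 0 < ε₀ ∧ ∀ ε δ : ℝ, 0 < ε → ε < ε₀ → δ = ε / (m * D ^ 2) →
          ∃ K : ℕ,
            -- the extra `m` gradients are those that recover the primal point from the output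
            (((dualSSNM A L δ x₁ K).queries (dualOracle (perturb δ f) A b) + m : ℕ) : ℝ) ≤
              C * (m + D * √(m / ε) * (∑ j, specNorm (A j)) / √(∑ i, lamMin (A i) / L i))
                * Real.log (1 / ε) ∧
            ∀ K' : ℕ, K ≤ K' →
              (dualSSNM A L δ x₁ K').expect (dualOracle (perturb δ f) A b)
                (fun x => |∑ i, f i (recoverPrimal (perturb δ f) A x i) - ∑ i, f i (yStar i)|)
                  < ε ∧
              (dualSSNM A L δ x₁ K').expect (dualOracle (perturb δ f) A b)
                (fun x => ‖constraintResidual A b (recoverPrimal (perturb δ f) A x)‖) < ε := by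
  refine ⟨100, by norm_num, ?_⟩
  intro m p n f A b L D yStar x₁ hL hc hs hD hy hyD hM
  have hm : 0 < m := by
    rcases Nat.eq_zero_or_pos m with rfl | h
    · simp at hM
    · exact h
  have hm1 : (1 : ℝ) ≤ m := by exact_mod_cast hm
  have : Nonempty (Fin m) := ⟨⟨0, hm⟩⟩
  obtain ⟨i₀, hi₀⟩ := Finite.exists_min L
  set M := ∑ i, lamMin (A i) / L i with hMd
  have hΛ := sum_lamMin_pos hM
  set Λ := ∑ i, lamMin (A i)
  have hS := sum_specNorm_pos hΛ
  set S := ∑ i, specNorm (A i)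
  set ρ := √(m * D ^ 2)
  set c1 := ∑ i, (‖gradient (f i) 0‖ + L i * ρ) * specNorm (A i)
  set c2 := ∑ i, L i / 2 * specNorm (A i) ^ 2 with hc2d
  set c3 := ∑ i, specNorm (A i) ^ 2 with hc3d
  set N := (m : ℝ) * D ^ 2 with hNd
  have hN : 0 < N := by positivity
  have hc2 : 0 ≤ c2 := Finset.sum_nonneg fun i _ => by have := hL i; positivity
  have hc3 : 0 < c3 := by
    refine (Finset.sum_nonneg fun i _ => sq_nonneg (specNorm (A i))).lt_of_ne fun h0 => ?_
    have h1 : Λ ≤ c3 := Finset.sum_le_sum fun i _ => lamMin_le_sq_specNorm (A i)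
    linarith
  -- An ε-free bound on ‖x₁ - xs‖², although xs depends on δ.
  set Q := 2 * ‖x₁‖ ^ 2 + 2 * ((∑ i, (‖gradient (f i) 0‖ + L i * ρ + ρ) ^ 2) / Λ) with hQd
  have hQ : 0 ≤ Q := by
    have : 0 ≤ ∑ i, (‖gradient (f i) 0‖ + L i * ρ + ρ) ^ 2 :=
      Finset.sum_nonneg fun i _ => sq_nonneg _
    positivity
  set P := (c1 ^ 2 + c3 ^ 2 + c2) * N ^ 2 * (1 + 2 * c3 * N / M) * Q with hPd
  have hP : 0 ≤ P := by positivity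
  -- The bounds on ε give, in order, log(1/ε) ≥ 1, the final accuracy, and δ ≤ min(1, Lᵢ), hence μ ≥
  -- M/2.
  refine ⟨min (min (Real.exp (-1)) (1 / (4 * (P + 1)))) (N * min 1 (L i₀)), ?_, ?_⟩
  · have := hL i₀
    have := Real.exp_pos (-1)
    positivity
  intro ε δ hε hε0 hδe
  rw [lt_min_iff, lt_min_iff] at hε0
  obtain ⟨⟨hεe, hεP⟩, hεN⟩ := hε0
  have hδ : 0 < δ := by rw [hδe]; positivity
  have hδmin : δ < min 1 (L i₀) := by
    rw [hδe, div_lt_iff₀ hN, mul_comm]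
    exact hεN
  have hδ1 : δ ≤ 1 := (hδmin.trans_le (min_le_left _ _)).le
  have hδL : ∀ i, δ ≤ L i := fun i => (hδmin.trans_le (min_le_right _ _)).le.trans (hi₀ i)
  have hε1 : ε ≤ 1 := hεe.le.trans (Real.exp_le_one_iff.2 (by norm_num))
  have hlog : 1 ≤ Real.log (1 / ε) := by
    rw [one_div, Real.log_inv]
    have := Real.log_lt_log hε hεe
    rw [Real.log_exp] at this
    linarith
  have hMδ := half_sum_le (A := A) hL hδ hδL
  rw [← hMd] at hMδ
  have hμ : 0 < ∑ i, lamMin (A i) / (L i + δ) := by linarith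
  have hsum : SSNM.sumSqrt (fun i => specNorm (A i) ^ 2 / δ) = S * √(1 / δ) := sumSqrt_specNorm
  have hSpos : 0 < SSNM.sumSqrt (fun i => specNorm (A i) ^ 2 / δ) := by
    rw [hsum]; positivity
  have hℓ : ∑ i, specNorm (A i) ^ 2 / δ = c3 / δ := by rw [← Finset.sum_div]
  obtain ⟨xs, hO, hxs⟩ := exists_dual_critical (A := A) (b := b) hm hL hδ hc hs hμ
    (by rw [hℓ]; positivity)
  have hR := (sum_recoverPrimal_le hL hδ hc hs hxs hy hyD).2.2
  have hdist : ‖x₁ - xs‖ ^ 2 ≤ Q := by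
    have h1 := sum_lamMin_mul_sq_norm_le hL hδ hδ1 hc hs hR
    rw [mul_comm, ← le_div_iff₀ hΛ] at h1
    have h2 := pow_le_pow_left₀ (norm_nonneg _) (norm_sub_le x₁ xs) 2
    have h3 := sq_nonneg (‖x₁‖ - ‖xs‖)
    rw [hQd]
    linarith
  obtain ⟨K, hK, hKle⟩ := SSNM.exists_iterations hSpos hμ hε hε1 6
  refine ⟨K, ?_, fun K' hKK => ?_⟩
  · have h1 := queries_dualSSNM_add_le (A := A) (L := L) (δ := δ)
      (O := dualOracle (perturb δ f) A b) x₁ K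
    have h2 := sumSqrt_div_sqrt_le (A := A) hD hδe hM hMδ
    have h3 : 0 ≤ D * √(m / ε) * S / √M := by positivity
    set X := D * √(m / ε) * S / √M
    set ℓ := Real.log (1 / ε)
    -- Here 24 = 4 · 6. The cost 2m + 2K is then at most 2m + 2 + (96X + 48m)ℓ, which 100(m + X)ℓ
    -- covers since m, ℓ ≥ 1.
    have h4 : (K : ℝ) ≤ 24 * (2 * X + m) * ℓ + 1 := by
      refine hKle.trans ?_
      norm_num
      gcongr
    have h5 : (m : ℝ) * 1 ≤ m * ℓ := by gcongr
    have h6 : 0 ≤ X * ℓ := by positivity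
    nlinarith
  -- One coefficient serves both errors: c1 and c2 come from the objective, c3 from the residual.
  -- The constant 3ε/4 is the bias ε/2 plus ε/4 from Young.
  · set c := ((c1 ^ 2 + c3 ^ 2) / ε + c2) / δ ^ 2 with hcd
    have hc0 : 0 ≤ c := by positivity
    have key : ∀ ψ : EuclideanSpace ℝ (Fin p) → ℝ,
        (∀ z, ψ z ≤ 3 * ε / 4 + c * ‖z - xs‖ ^ 2) →
        (dualSSNM A L δ x₁ K').expect (dualOracle (perturb δ f) A b) ψ < ε := fun ψ hψ =>
      (expect_dualSSNM_le hL hδ hc hs hSpos hμ hO hc0 hψ x₁ K').trans_lt <|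
        accuracy_lt hε hε1 hN hM hδe (by positivity) hc2 hc3 hMδ (sq_nonneg _) hdist
          (pow_nonneg (SSNM.one_sub_lam_nonneg hSpos hμ) _) (hK K' hKK) hεP
    have hr : ∀ z, c * ‖z - xs‖ ^ 2 = c1 ^ 2 / ε * (‖z - xs‖ / δ) ^ 2
        + c3 ^ 2 / ε * (‖z - xs‖ / δ) ^ 2 + c2 * (‖z - xs‖ / δ) ^ 2 := by
      intro z
      rw [hcd]; field_simp
    have hnn : ∀ a z, 0 ≤ a → 0 ≤ a * (‖z - xs‖ / δ) ^ 2 := fun a z ha =>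
      mul_nonneg ha (sq_nonneg _)
    constructor
    · refine key _ fun z => ?_
      have h1 := abs_sum_recoverPrimal_sub_le hL hδ hc hs hxs hy hyD z
      have h2 := linear_le_quadratic (c := c1) (r := ‖z - xs‖ / δ) hε
      have h3 : δ / 2 * N = ε / 2 := by rw [hδe]; field_simp
      have h4 := hnn (c3 ^ 2 / ε) z (by positivity)
      rw [h3] at h1
      rw [hr]
      linarith
    · refine key _ fun z => ?_
      have h1 := norm_constraintResidual_recoverPrimal_le hL hδ hc hs hxs z
      have h2 := linear_le_quadratic (c := c3) (r := ‖z - xs‖ / δ) hε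
      have h3 := hnn (c1 ^ 2 / ε) z (by positivity)
      have h4 := hnn c2 z hc2
      rw [hr]
      linarith
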